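/- Let $\Lambda$ be the ring of symmetric functions in the variables $\mathbf{x}=x_1,x_2,x_3,\dots$, with $p_k$, $h_n$, $e_n$, $s_\mu$ the power sum, complete homogeneous, elementary and Schur symmetric functions. Over $\mathbb{Q}(q)$, let $f[g]$ denote plethysm: $f\mapsto f[g]$ is the $\mathbb{Q}(q)$-algebra homomorphism with $p_k\mapsto p_k[g]$, where $g\mapsto p_k[g]$ is the ring homomorphism $x_i\mapsto x_i^k$, $q\mapsto q^k$. For $n\ge 0$ put $$H_n(\mathbf{x};q)=[n]_q!\,(1-q)^n\,h_n\!\left[\frac{\mathbf{x}}{1-q}\right],\qquad [n]_q!=\prod_{k=1}^n(1+q+\dots+q^{k-1}),$$ where $\mathbf{x}$ inside the brackets stands for $x_1+x_2+x_3+\cdots$, and let $$F_{a,b}(\mathbf{x};q)=\frac{H_b[H_a]-H_a[H_b]}{1-q},\qquad \mathcal{O}_n=\tfrac12\left((h_2+e_2)^n-(h_2-e_2)^n\right).$$ **Proposition 3.1.** For all integers $1<a<b$, the coefficients of $F_{a,b}(\mathbf{x};q)$ are polynomials in $q$, and its value at $q=1$ is $$F_{a,b}(\mathbf{x};1)=\frac12\left(ab(b-a)\,h_1^{ab-2}e_2+a(a-1)\,h_1^{(a-2)b}\,\mathcal{O}_b-b(b-1)\,h_1^{a(b-2)}\,\mathcal{O}_a\right).$$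 Moreover, $F_{a,b}(\mathbf{x};1)$ can be written as a polynomial in $h_1$, $h_2$ and $e_2$ with nonnegative integer coefficients, and it is a linear combination of Schur functions $s_\mu$ with nonnegative integer coefficients. -/

import Mathlib

noncomputable section

namespace SymFun

/-! ### Symmetric functions in the variables `x₀, x₁, x₂, …`

Symmetric functions are realised as formal power series in countably many variables. -/

section Basic

variable {R : Type*} [CommSemiring R]

open Classical in
/-- The power sum `p_k = ∑ᵢ xᵢ ^ k` (used for `k ≥ 1`). -/
def p (k : ℕ) : MvPowerSeries ℕ R :=
  fun m => if ∃ i, m = Finsupp.single i k then 1 else 0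

/-- The complete homogeneous symmetric function `h_n`: the sum of all monomials of degree `n`. -/
def h (n : ℕ) : MvPowerSeries ℕ R :=
  fun m => if m.degree = n then 1 else 0

open Classical in
/-- The elementary symmetric function `e_n`: the sum of all squarefree monomials of degree `n`. -/
def e (n : ℕ) : MvPowerSeries ℕ R :=
  fun m => if m.degree = n ∧ ∀ i, m i ≤ 1 then 1 else 0

end Basic

/-- The Schur function `s_μ = det (h_{μ_i - i + j})`, with `i, j` running over the rows of `μ`
and with `h_n = 0` for negative `n`. -/
def schur (μ : YoungDiagram) : MvPowerSeries ℕ ℚ :=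
  Matrix.det (Matrix.of fun i j : Fin (μ.colLen 0) =>
    if (i : ℕ) ≤ μ.rowLen i + j then h (μ.rowLen i + j - i) else 0)

/-- `f` is a linear combination of Schur functions with coefficients in `ℕ`. -/
def SchurPositive (f : MvPowerSeries ℕ ℚ) : Prop :=
  ∃ c : YoungDiagram →₀ ℕ, f = c.sum fun μ n => n • schur μ

/-! ### Coefficients in `ℚ(q)`, and plethysm -/

/-- The field `ℚ(q)`. -/
abbrev Kq : Type := RatFunc ℚ

/-- The indeterminate `q`. -/
abbrev q : Kq := RatFunc.X

/-- The endomorphism `q ↦ q ^ k` of `ℚ(q)`. -/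
def qPow (k : ℕ+) : Kq →+* Kq :=
  RatFunc.mapRingHom (Polynomial.expand ℚ (k : ℕ))
    (nonZeroDivisors_le_comap_nonZeroDivisors_of_injective _
      (Polynomial.expand_injective k.pos))

/-- The plethysm `g ↦ p_k[g]`: the ring endomorphism `xᵢ ↦ xᵢ ^ k`, `q ↦ q ^ k`. -/
def adams (k : ℕ+) : MvPowerSeries ℕ Kq →+* MvPowerSeries ℕ Kq :=
  (MvPowerSeries.expand (k : ℕ) k.ne_zero).toRingHom.comp (MvPowerSeries.map (qPow k))

open Classical in
/-- The plethysm `f[g]`. Every symmetric function `f` is, in a unique way, a polynomial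
`P(p₁, p₂, …)` in the power sums with coefficients in `ℚ(q)`, and then
`f[g] = P(p₁[g], p₂[g], …)`. (The value is `0` if `f` is not a symmetric function.) -/
def plethysm (f g : MvPowerSeries ℕ Kq) : MvPowerSeries ℕ Kq :=
  if hf : ∃ P : MvPolynomial ℕ+ Kq, MvPolynomial.aeval (fun k : ℕ+ => p (k : ℕ)) P = f then
    MvPolynomial.aeval (fun k : ℕ+ => adams k g) hf.choose
  else 0

/-- The `q`-analog `[n]_q! = [1]_q [2]_q ⋯ [n]_q`, with `[k]_q = 1 + q + ⋯ + q ^ (k - 1)`. -/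
def qFactorial (n : ℕ) : Kq :=
  ∏ k ∈ Finset.Icc 1 n, ∑ j ∈ Finset.range k, q ^ j

/-- The Hall-Littlewood symmetric function
`H_n(x; q) = [n]_q! (1 - q)^n h_n[x / (1 - q)]`, where `x = x₀ + x₁ + x₂ + ⋯ = p₁`. -/
def H (n : ℕ) : MvPowerSeries ℕ Kq :=
  (qFactorial n * (1 - q) ^ n) • plethysm (h n) ((1 - q)⁻¹ • p 1)

/-- The divided difference `F_{a,b}(x; q) = (H_b[H_a] - H_a[H_b]) / (1 - q)`. -/
def F (a b : ℕ) : MvPowerSeries ℕ Kq :=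
  (1 - q)⁻¹ • (plethysm (H b) (H a) - plethysm (H a) (H b))

/-- `f(x; q)` has coefficients that are polynomials in `q`, and evaluating these at `q = t` gives
the series `f₀`, that is, `f(x; t) = f₀(x)`. -/
def HasValueAt (f : MvPowerSeries ℕ Kq) (t : ℚ) (f₀ : MvPowerSeries ℕ ℚ) : Prop :=
  ∃ G : MvPowerSeries ℕ (Polynomial ℚ),
    MvPowerSeries.map (algebraMap (Polynomial ℚ) Kq) G = f ∧
    MvPowerSeries.map (Polynomial.evalRingHom t) G = f₀

/-- `O_n`, the part of `(h₂ + e₂)^n` that is odd in `e₂`. -/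
def oddPart (n : ℕ) : MvPowerSeries ℕ ℚ :=
  (1 / 2 : ℚ) • ((h 2 + e 2) ^ n - (h 2 - e 2) ^ n)

/-- `f` is a polynomial in `h₁, h₂, e₂` with coefficients in `ℕ`. -/
def IsNatPolynomial (f : MvPowerSeries ℕ ℚ) : Prop :=
  ∃ P : MvPolynomial (Fin 3) ℕ,
    f = MvPolynomial.eval₂ (Nat.castRingHom (MvPowerSeries ℕ ℚ)) ![h 1, h 2, e 2] P

end SymFun

end

/-! The power sums are algebraically independent, so plethysm is computed on any expression in them,
and h_n is governed by Newton's recursion n h_n = ∑ p_k h_{n-k}. Substituting G/(1-q) and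
multiplying by (1-q)(1-q²)⋯(1-qⁿ) gives a recursion for H_n[G] whose weights (`hallWeight`) are
polynomials in q, so H_b[H_a] has coefficients in ℚ[q]. The weight of p_{k+1}[G] is divisible by
(1-q)^k. Hence modulo (1-q)² only G and p_2[G] matter, and H_n[G] ≡ Gⁿ - n(n-1)/4 · (1-q)(G² -
p_2[G]) G^{n-2}. Applied twice, this shows that both plethysms reduce to p_1^{ab} modulo 1-q, and
the first-order terms of their difference give the value at q = 1 (`valueAtOne`). The relations p_1²
= h_2 + e_2 and p_2 = h_2 - e_2 turn it into the required formula.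

For positivity put x = h_2, y = e_2 and D_n = (O_n - n(x+y)^{n-1}y)/(n(n-1)) (`oddDefect`). The
value is h_1^{(a-2)b} times a positive multiple of D_b - (x+y)^{b-a} D_a, and D_{n+1} - (x+y)D_n is
a positive multiple of y ∑ O_i O_{n-i}; telescoping gives nonnegative coefficients. Integrality is a
separate matter of binomial coefficients. Schur positivity then follows from the Pieri rules for
h_1, h_2 and e_2, proved by manipulating Jacobi-Trudi determinants. -/

noncomputable section

namespace SymFun

/-! ### Algebraic independence of the power sums, and plethysm as substitution. -/

section AlgebraicIndependence

open MvPolynomial Finset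

/-- A surjective endomorphism of a Noetherian commutative ring is injective. -/
theorem injective_of_surjective_ringEnd {A : Type*} [CommRing A] [IsNoetherianRing A]
    (f : A →+* A) (hf : Function.Surjective f) : Function.Injective f := by
  have hmono : Monotone fun n : ℕ => RingHom.ker (f ^ n) := by
    refine monotone_nat_of_le_succ fun n x hx => ?_
    rw [RingHom.mem_ker] at hx ⊢
    rw [pow_succ', RingHom.mul_def, RingHom.comp_apply, hx, map_zero]
  -- The kernels of the iterates stabilise at some n. Writing x in ker f as fⁿ(y) puts y in ker fⁿ⁺¹
  -- = ker fⁿ, so x = 0.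
  obtain ⟨n, hn⟩ := monotone_stabilizes_iff_noetherian.2 (inferInstance : IsNoetherian A A)
    ⟨_, hmono⟩
  rw [injective_iff_map_eq_zero]
  intro x hx
  have hsurj : Function.Surjective (f ^ n) := by
    rw [RingHom.coe_pow]
    exact hf.iterate n
  obtain ⟨y, rfl⟩ := hsurj x
  have h1 : y ∈ RingHom.ker (f ^ (n + 1)) := by
    rw [RingHom.mem_ker, pow_succ', RingHom.mul_def, RingHom.comp_apply, hx]
  have h2 := hn (n + 1) (Nat.le_succ n)
  simp only [OrderHom.coe_mk] at h2
  rwa [← h2, RingHom.mem_ker] at h1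

variable {K : Type*} [Field K] [CharZero K]

/-- Newton's identities express k e_k through p_1, …, p_k and earlier e_j; characteristic zero
allows division by k. The bound k ≤ N keeps the indices among the N available power sums. -/
theorem esymm_mem_range_aeval_psum (N k : ℕ) (hk : k ≤ N) :
    esymm (Fin N) K k ∈ (aeval (fun i : Fin N => psum (Fin N) K (i + 1)) :
      MvPolynomial (Fin N) K →ₐ[K] MvPolynomial (Fin N) K).range := by
  induction k using Nat.strong_induction_on with
  | _ k ih =>
    rcases Nat.eq_zero_or_pos k with rfl | hpos
    · rw [esymm_zero]; exact one_mem _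
    have hN := mul_esymm_eq_sum (Fin N) K k
    have hk0 : (k : K) ≠ 0 := Nat.cast_ne_zero.2 hpos.ne'
    have key : esymm (Fin N) K k = (k : K)⁻¹ • ((k : MvPolynomial (Fin N) K) * esymm (Fin N) K k) := by
      rw [← map_natCast (C : K →+* MvPolynomial (Fin N) K), ← smul_eq_C_mul, smul_smul,
        inv_mul_cancel₀ hk0, one_smul]
    rw [key, hN]
    refine Subalgebra.smul_mem _ (mul_mem (pow_mem (neg_mem (one_mem _)) _) (sum_mem ?_)) _
    intro a ha
    rw [mem_filter, HasAntidiagonal.mem_antidiagonal] at ha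
    refine mul_mem (mul_mem (pow_mem (neg_mem (one_mem _)) _) (ih _ ha.2 (by omega))) ?_
    refine ⟨X ⟨a.2 - 1, by omega⟩, ?_⟩
    simp only [AlgHom.toRingHom_eq_coe, RingHom.coe_coe, aeval_X]
    congr 1
    omega

/-- By the fundamental theorem p_i = r_i(e_1, …, e_N), so the map factors as the injective
substitution of the e_i after X_i ↦ r_i. The latter endomorphism is surjective because the e_i are
polynomials in the p_i, hence injective by the Noetherian property. -/
theorem aeval_psum_injective (N : ℕ) :
    Function.Injective (aeval (fun i : Fin N => psum (Fin N) K (i + 1)) :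
      MvPolynomial (Fin N) K →ₐ[K] MvPolynomial (Fin N) K) := by
  have hbij := esymmAlgHom_fin_bijective K N
  choose r hr using fun i : Fin N =>
    hbij.2 ⟨psum (Fin N) K (i + 1), psum_isSymmetric (Fin N) K _⟩
  let ε : MvPolynomial (Fin N) K →ₐ[K] MvPolynomial (Fin N) K :=
    aeval fun i : Fin N => esymm (Fin N) K (i + 1)
  have hε : Function.Injective ε := by
    intro a b hab
    apply hbij.1
    apply Subtype.ext
    rw [esymmAlgHom_apply, esymmAlgHom_apply]
    exact hab
  have hcomp : (aeval (fun i : Fin N => psum (Fin N) K (i + 1)) :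
      MvPolynomial (Fin N) K →ₐ[K] MvPolynomial (Fin N) K) = ε.comp (aeval r) := by
    refine MvPolynomial.algHom_ext fun i => ?_
    rw [aeval_X, AlgHom.comp_apply, aeval_X]
    have := congrArg Subtype.val (hr i)
    rw [esymmAlgHom_apply] at this
    exact this.symm
  rw [hcomp, AlgHom.coe_comp]
  refine hε.comp (injective_of_surjective_ringEnd (aeval r : _ →ₐ[K] _).toRingHom ?_)
  have hX : ∀ i, X i ∈ (aeval r : MvPolynomial (Fin N) K →ₐ[K] MvPolynomial (Fin N) K).range := by
    intro i
    obtain ⟨P, hP⟩ := esymm_mem_range_aeval_psum (K := K) N (i + 1) i.2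
    refine ⟨P, hε ?_⟩
    simp only [AlgHom.toRingHom_eq_coe, RingHom.coe_coe] at hP ⊢
    rw [hcomp, AlgHom.comp_apply] at hP
    rw [hP]
    simp [ε]
  have htop : (aeval r : MvPolynomial (Fin N) K →ₐ[K] MvPolynomial (Fin N) K).range = ⊤ := by
    rw [eq_top_iff, ← MvPolynomial.adjoin_range_X, Algebra.adjoin_le_iff]
    rintro _ ⟨i, rfl⟩
    exact hX i
  exact AlgHom.range_eq_top _ |>.1 htop

/-- Setting all but the first N variables to zero reduces independence to finitely many variables.
-/
theorem killCompl_p (N k : ℕ) (hk : k ≠ 0) :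
    MvPowerSeries.killCompl Fin.valEmbedding (p k : MvPowerSeries ℕ K) =
      (psum (Fin N) K k : MvPowerSeries (Fin N) K) := by
  classical
  ext m
  rw [MvPowerSeries.coeff_killCompl, MvPolynomial.coeff_coe, psum, coeff_sum]
  simp only [coeff_X_pow]
  change (if _ then _ else _) = _
  split_ifs with hm
  · obtain ⟨i, hi⟩ := hm
    have hi' : i ∈ Set.range (Fin.valEmbedding : Fin N ↪ ℕ) := by
      have : i ∈ (Finsupp.embDomain Fin.valEmbedding m).support := by
        rw [hi, Finsupp.mem_support_iff, Finsupp.single_eq_same]; exact hk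
      rw [Finsupp.support_embDomain, mem_map] at this
      obtain ⟨j, -, hj⟩ := this
      exact ⟨j, hj⟩
    obtain ⟨j, rfl⟩ := hi'
    rw [← Finsupp.embDomain_single, (Finsupp.embDomain_injective _).eq_iff] at hi
    rw [sum_eq_single j, if_pos hi.symm]
    · intro b _ hb
      rw [if_neg]
      intro h
      exact hb (Finsupp.single_left_injective hk (h.trans hi))
    · simp
  · rw [sum_eq_zero]
    intro j _
    rw [if_neg]
    rintro rfl
    exact hm ⟨j, by rw [Finsupp.embDomain_single]; rfl⟩

/-- The power sums `p₁, p₂, …` are algebraically independent. -/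
theorem aeval_p_injective :
    Function.Injective (aeval (fun k : ℕ+ => (p (k : ℕ) : MvPowerSeries ℕ K)) :
      MvPolynomial ℕ+ K →ₐ[K] MvPowerSeries ℕ K) := by
  rw [injective_iff_map_eq_zero]
  intro P hP
  obtain ⟨N, hN⟩ : ∃ N : ℕ, ∀ k ∈ P.vars, (k : ℕ) ≤ N :=
    ⟨P.vars.sup fun k => (k : ℕ), fun k hk => Finset.le_sup (f := fun k : ℕ+ => (k : ℕ)) hk⟩
  let g : Fin N → ℕ+ := fun i => ⟨i + 1, Nat.succ_pos _⟩
  have hg : Function.Injective g := by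
    intro i j hij
    have := congrArg (fun k : ℕ+ => (k : ℕ)) hij
    simp only [g, PNat.mk_coe] at this
    exact Fin.ext (by omega)
  obtain ⟨Q, rfl⟩ := exists_rename_eq_of_vars_subset_range P g hg (by
    intro k hk
    refine ⟨⟨k - 1, ?_⟩, ?_⟩
    · have := hN k hk
      have := k.pos
      omega
    · apply PNat.eq
      simp only [g, PNat.mk_coe]
      have := k.pos
      omega)
  rw [aeval_rename] at hP
  have h1 := congrArg (MvPowerSeries.killCompl (Fin.valEmbedding : Fin N ↪ ℕ)) hP
  rw [map_zero, ← AlgHom.comp_apply, comp_aeval] at h1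
  have h2 : ((aeval (fun i : Fin N => psum (Fin N) K (i + 1)) Q : MvPolynomial (Fin N) K) :
      MvPowerSeries (Fin N) K) = 0 := by
    rw [← h1]
    have : (MvPolynomial.coeToMvPowerSeries.algHom K).comp
        (aeval (fun i : Fin N => psum (Fin N) K (i + 1))) =
        aeval fun i : Fin N => (psum (Fin N) K (i + 1) : MvPowerSeries (Fin N) K) := by
      refine MvPolynomial.algHom_ext fun i => ?_
      simp
    have h3 := DFunLike.congr_fun this Q
    simp only [AlgHom.comp_apply, MvPolynomial.coeToMvPowerSeries.algHom_apply,
      Algebra.algebraMap_self, MvPowerSeries.map_id, RingHom.id_apply] at h3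
    rw [h3]
    congr 2
    funext i
    exact (killCompl_p N (i + 1) (Nat.succ_ne_zero _)).symm
  have h4 : aeval (fun i : Fin N => psum (Fin N) K (i + 1)) Q = 0 := by
    apply MvPolynomial.coe_injective
    rw [h2, MvPolynomial.coe_zero]
  rw [(injective_iff_map_eq_zero _).1 (aeval_psum_injective N) Q h4, map_zero]

/-- Independence makes the polynomial chosen in the definition of `plethysm` equal to any given one.
-/
theorem plethysm_aeval (P : MvPolynomial ℕ+ Kq) (g : MvPowerSeries ℕ Kq) :
    plethysm (aeval (fun k : ℕ+ => p (k : ℕ)) P) g = aeval (fun k : ℕ+ => adams k g) P := by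
  have hf : ∃ Q : MvPolynomial ℕ+ Kq, aeval (fun k : ℕ+ => (p (k : ℕ) : MvPowerSeries ℕ Kq)) Q =
      aeval (fun k : ℕ+ => p (k : ℕ)) P := ⟨P, rfl⟩
  rw [plethysm, dif_pos hf, aeval_p_injective hf.choose_spec]

end AlgebraicIndependence

open Finset

/-! ### Newton type recursions and uniqueness of their solutions. -/

section Newton

variable {B : Type*} [CommRing B]

/-- The sequence `u` satisfies the Newton type recursion
`(n + 1) u_{n + 1} = ∑_{k ≤ n} c_{n,k} u_{n - k}` with `u_0 = 1`. -/
def IsNewton (c : ℕ → ℕ → B) (u : ℕ → B) : Prop :=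
  u 0 = 1 ∧ ∀ n : ℕ, ((n + 1 : ℕ) : B) * u (n + 1) = ∑ k ∈ range (n + 1), c n k * u (n - k)

/-- The solution of the Newton type recursion with coefficients `c`. -/
def newton [Algebra ℚ B] (c : ℕ → ℕ → B) : ℕ → B
  | 0 => 1
  | n + 1 => ((n + 1 : ℕ) : ℚ)⁻¹ • ∑ k : Fin (n + 1), c n k * newton c (n - k)

theorem isNewton_newton [Algebra ℚ B] (c : ℕ → ℕ → B) : IsNewton c (newton c) := by
  refine ⟨by rw [newton], fun n => ?_⟩
  rw [newton, ← map_natCast (algebraMap ℚ B), ← Algebra.smul_def, smul_smul,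
    mul_inv_cancel₀ (Nat.cast_ne_zero.2 n.succ_ne_zero), one_smul,
    Finset.sum_range fun k => c n k * newton c (n - k)]

theorem natCast_succ_mul_cancel [Algebra ℚ B] {n : ℕ} {x y : B}
    (hxy : ((n + 1 : ℕ) : B) * x = ((n + 1 : ℕ) : B) * y) : x = y := by
  have hu : IsUnit ((n + 1 : ℕ) : B) := by
    rw [← map_natCast (algebraMap ℚ B)]
    exact (IsUnit.mk0 _ (Nat.cast_ne_zero.2 n.succ_ne_zero)).map _
  exact hu.mul_left_cancel hxy

theorem IsNewton.congr {c c' : ℕ → ℕ → B} {u : ℕ → B} (hu : IsNewton c u)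
    (hc : ∀ n k, k ≤ n → c n k = c' n k) : IsNewton c' u := by
  refine ⟨hu.1, fun n => ?_⟩
  rw [hu.2 n]
  refine sum_congr rfl fun k hk => ?_
  rw [hc n k (Nat.lt_succ_iff.1 (mem_range.1 hk))]

theorem IsNewton.unique [Algebra ℚ B] {c : ℕ → ℕ → B} {u v : ℕ → B}
    (hu : IsNewton c u) (hv : IsNewton c v) : u = v := by
  funext n
  induction n using Nat.strong_induction_on with
  | _ n ih =>
    cases n with
    | zero => rw [hu.1, hv.1]
    | succ n =>
      apply natCast_succ_mul_cancel
      rw [hu.2, hv.2]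
      exact sum_congr rfl fun k _ => by rw [ih (n - k) (by omega)]

theorem IsNewton.map {A : Type*} [CommRing A] {c : ℕ → ℕ → B} {u : ℕ → B}
    (hu : IsNewton c u) (f : B →+* A) : IsNewton (fun n k => f (c n k)) (fun n => f (u n)) := by
  refine ⟨by dsimp only; rw [hu.1, map_one], fun n => ?_⟩
  rw [← map_natCast f, ← map_mul, hu.2, map_sum]
  simp only [map_mul]

end Newton

/-! ### Newton's recursion for the complete homogeneous functions. -/

section Complete

variable {R : Type*} [CommRing R]

theorem map_p {S : Type*} [CommRing S] (f : R →+* S) (k : ℕ) :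
    MvPowerSeries.map f (p k) = p k := by
  classical
  ext m
  rw [MvPowerSeries.coeff_map]
  change f (if _ then _ else _) = if _ then _ else _
  split_ifs <;> simp

theorem coeff_h (n : ℕ) (m : ℕ →₀ ℕ) :
    MvPowerSeries.coeff m (h n : MvPowerSeries ℕ R) = if m.degree = n then 1 else 0 := rfl

theorem coeff_p_mul (k : ℕ) (f : MvPowerSeries ℕ R) (m : ℕ →₀ ℕ) :
    MvPowerSeries.coeff m (p (k + 1) * f) =
      ∑ i ∈ m.support with k + 1 ≤ m i,
        MvPowerSeries.coeff (m - Finsupp.single i (k + 1)) f := by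
  classical
  rw [MvPowerSeries.coeff_mul]
  symm
  refine Finset.sum_of_injOn
    (fun i => (Finsupp.single i (k + 1), m - Finsupp.single i (k + 1))) ?_ ?_ ?_ ?_
  · intro i _ j _ hij
    exact Finsupp.single_left_injective (Nat.succ_ne_zero k) (Prod.ext_iff.1 hij).1
  · intro i hi
    rw [mem_coe, mem_filter] at hi
    rw [mem_coe, HasAntidiagonal.mem_antidiagonal]
    exact add_tsub_cancel_of_le (Finsupp.single_le_iff.2 hi.2)
  · rintro ⟨a, b⟩ hab hni
    rw [HasAntidiagonal.mem_antidiagonal] at hab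
    change (if _ then _ else _) * _ = _
    rw [if_neg, zero_mul]
    rintro ⟨i, hi⟩
    apply hni
    dsimp only at hab hi
    subst hi
    have hle : k + 1 ≤ m i := by
      rw [← hab, Finsupp.add_apply, Finsupp.single_eq_same]
      omega
    refine ⟨i, ?_, ?_⟩
    · rw [mem_coe, mem_filter, Finsupp.mem_support_iff]
      exact ⟨by omega, hle⟩
    · dsimp only
      rw [← hab, add_tsub_cancel_left]
  · intro i _
    change _ = (if _ then _ else _) * _
    rw [if_pos ⟨i, rfl⟩, one_mul]

theorem isNewton_h : IsNewton (fun _ k => p (k + 1)) (h : ℕ → MvPowerSeries ℕ R) := by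
  classical
  refine ⟨?_, fun n => ?_⟩
  · ext m
    rw [coeff_h, MvPowerSeries.coeff_one]
    simp only [Finsupp.degree_eq_zero_iff]
  · ext m
    rw [map_sum, ← map_natCast (MvPowerSeries.C : R →+* MvPowerSeries ℕ R),
      MvPowerSeries.coeff_C_mul, coeff_h]
    have hterm : ∀ k ∈ range (n + 1), MvPowerSeries.coeff m (p (k + 1) * h (n - k)) =
        if m.degree = n + 1 then ∑ i ∈ m.support, (if k + 1 ≤ m i then (1 : R) else 0) else 0 := by
      intro k hk
      rw [mem_range] at hk
      rw [coeff_p_mul, sum_filter]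
      split_ifs with hm
      · refine sum_congr rfl fun i _ => ?_
        split_ifs with hi
        · rw [coeff_h, if_pos]
          have := congrArg Finsupp.degree (tsub_add_cancel_of_le (Finsupp.single_le_iff.2 hi))
          rw [map_add, Finsupp.degree_single] at this
          omega
        · rfl
      · refine sum_eq_zero fun i _ => ?_
        split_ifs with hi
        · rw [coeff_h, if_neg]
          have := congrArg Finsupp.degree (tsub_add_cancel_of_le (Finsupp.single_le_iff.2 hi))
          rw [map_add, Finsupp.degree_single] at this
          omega
        · rfl
    rw [sum_congr rfl hterm]
    split_ifs with hm
    · rw [sum_comm, mul_one]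
      -- The variable x_i can supply the factor x_i^{k+1} for exactly m_i values of k, so the total
      -- count is the degree n + 1.
      have : ∀ i ∈ m.support, ∑ k ∈ range (n + 1), (if k + 1 ≤ m i then (1 : R) else 0) = m i := by
        intro i hi
        have hle : m i ≤ n + 1 := hm ▸ Finsupp.le_degree i m
        rw [← sum_filter, sum_const, nsmul_eq_mul, mul_one]
        congr 1
        have : {k ∈ range (n + 1) | k + 1 ≤ m i} = range (m i) := by
          ext k
          rw [mem_filter, mem_range, mem_range]
          omega
        rw [this, card_range]
      rw [sum_congr rfl this, ← Nat.cast_sum, ← hm]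
      rfl
    · rw [mul_zero, sum_const_zero]

end Complete

/-! ### Plethysm with H_n over ℚ[q]. -/

section HallLittlewood

/-- The polynomial `(1 - q^{n+1}) (1 - q^n) ⋯ (1 - q^{n+1-k}) / (1 - q^{k+1})`. -/
def hallWeight (n k : ℕ) : Polynomial ℚ :=
  (∏ j ∈ range (k + 1), (1 - Polynomial.X ^ (n + 1 - j))) / (1 - Polynomial.X ^ (k + 1))

theorem one_sub_X_pow_ne_zero (k : ℕ) : (1 - Polynomial.X ^ (k + 1) : Polynomial ℚ) ≠ 0 := by
  intro h0
  have := congrArg (Polynomial.eval 0) h0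
  simp at this

theorem hallWeight_mul (n k : ℕ) :
    hallWeight n k * (1 - Polynomial.X ^ (k + 1)) =
      ∏ j ∈ range (k + 1), (1 - Polynomial.X ^ (n + 1 - j)) := by
  rw [mul_comm, hallWeight]
  refine EuclideanDomain.mul_div_cancel' (one_sub_X_pow_ne_zero k) ?_
  -- The factor with j = (n + 1) mod (k + 1) has an exponent divisible by k + 1, which makes the
  -- division in `hallWeight` exact.
  have hlt : (n + 1) % (k + 1) < k + 1 := Nat.mod_lt _ k.succ_pos
  refine dvd_trans ?_ (dvd_prod_of_mem (fun j => (1 - Polynomial.X ^ (n + 1 - j) : Polynomial ℚ))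
    (mem_range.2 hlt))
  obtain ⟨r, hr⟩ := Nat.dvd_sub_mod (n := k + 1) (n + 1)
  rw [hr, pow_mul]
  exact one_sub_dvd_one_sub_pow _ _

/-- The endomorphism `xᵢ ↦ xᵢ ^ k`, `q ↦ q ^ k` of the power series over `ℚ[q]`. -/
def polyAdams (k : ℕ+) : MvPowerSeries ℕ (Polynomial ℚ) →+* MvPowerSeries ℕ (Polynomial ℚ) :=
  (MvPowerSeries.expand (k : ℕ) k.ne_zero).toRingHom.comp
    (MvPowerSeries.map (Polynomial.expand ℚ (k : ℕ)).toRingHom)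

theorem qPow_algebraMap (k : ℕ+) (f : Polynomial ℚ) :
    qPow k (algebraMap _ Kq f) = algebraMap _ Kq (Polynomial.expand ℚ (k : ℕ) f) := by
  have h1 := RatFunc.map_apply_div (Polynomial.expand ℚ (k : ℕ))
    (nonZeroDivisors_le_comap_nonZeroDivisors_of_injective _
      (Polynomial.expand_injective k.pos)) f 1
  rw [map_one, map_one, map_one, div_one, div_one] at h1
  exact h1

theorem qPow_q (k : ℕ+) : qPow k q = q ^ (k : ℕ) := by
  have := qPow_algebraMap k Polynomial.X
  rw [RatFunc.algebraMap_X] at this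
  rw [this, Polynomial.expand_X, map_pow, RatFunc.algebraMap_X]

theorem adams_map (k : ℕ+) (G : MvPowerSeries ℕ (Polynomial ℚ)) :
    adams k (MvPowerSeries.map (algebraMap _ Kq) G) =
      MvPowerSeries.map (algebraMap _ Kq) (polyAdams k G) := by
  have h1 : (qPow k).comp (algebraMap (Polynomial ℚ) Kq) =
      (algebraMap (Polynomial ℚ) Kq).comp (Polynomial.expand ℚ (k : ℕ)).toRingHom :=
    RingHom.ext fun f => qPow_algebraMap k f
  simp only [adams, polyAdams, RingHom.comp_apply, AlgHom.toRingHom_eq_coe, RingHom.coe_coe,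
    MvPowerSeries.map_expand]
  congr 1
  rw [← RingHom.comp_apply, ← MvPowerSeries.map_comp, h1, MvPowerSeries.map_comp]
  rfl

theorem expand_p_one {R : Type*} [CommRing R] (k : ℕ+) :
    MvPowerSeries.expand (k : ℕ) k.ne_zero (p 1 : MvPowerSeries ℕ R) = p (k : ℕ) := by
  classical
  ext m
  by_cases hm : ∀ i, (k : ℕ) ∣ m i
  · obtain ⟨d, rfl⟩ : ∃ d : ℕ →₀ ℕ, (k : ℕ) • d = m :=
      ⟨m.mapRange (fun a => a / k) (by simp), by ext i; simp [Nat.mul_div_cancel' (hm i)]⟩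
    rw [MvPowerSeries.coeff_expand_smul]
    change (if _ then _ else _) = if _ then _ else _
    congr 1
    refine propext (exists_congr fun i => ?_)
    constructor
    · rintro rfl
      simp
    · intro hi
      ext j
      have := DFunLike.congr_fun hi j
      rw [Finsupp.smul_apply, Finsupp.single_apply] at this
      rw [Finsupp.single_apply]
      have hk := k.pos
      split_ifs with hij
      · rw [if_pos hij] at this
        exact Nat.eq_of_mul_eq_mul_left hk (by simpa using this)
      · rw [if_neg hij] at this
        exact Nat.eq_of_mul_eq_mul_left hk (by simpa using this)
  · push Not at hm
    obtain ⟨i, hi⟩ := hm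
    rw [MvPowerSeries.coeff_expand_of_not_dvd _ _ _ hi]
    change _ = if _ then _ else _
    rw [if_neg]
    rintro ⟨j, rfl⟩
    apply hi
    rw [Finsupp.single_apply]
    split_ifs <;> simp

theorem adams_p_one (k : ℕ+) : adams k (p 1) = p (k : ℕ) := by
  rw [adams, RingHom.comp_apply, map_p]
  exact expand_p_one k

theorem polyAdams_p_one (k : ℕ+) : polyAdams k (p 1) = p (k : ℕ) := by
  rw [polyAdams, RingHom.comp_apply, map_p]
  exact expand_p_one k

theorem adams_smul (k : ℕ+) (c : Kq) (f : MvPowerSeries ℕ Kq) :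
    adams k (c • f) = qPow k c • adams k f := by
  rw [MvPowerSeries.smul_eq_C_mul, map_mul, MvPowerSeries.smul_eq_C_mul]
  congr 1
  simp only [adams, RingHom.comp_apply, MvPowerSeries.map_C]
  exact MvPowerSeries.expand_C _ _ _

/-- The coefficient `(1 - q)(1 - q²) ⋯ (1 - qⁿ)` in the definition of `H n`. -/
def qPoch (n : ℕ) : Kq := qFactorial n * (1 - q) ^ n

theorem qPoch_succ (n : ℕ) : qPoch (n + 1) = qPoch n * (1 - q ^ (n + 1)) := by
  have hg : (1 - q) * ∑ j ∈ range (n + 1), q ^ j = 1 - q ^ (n + 1) := mul_neg_geom_sum q (n + 1)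
  rw [qPoch, qPoch, qFactorial, qFactorial, prod_Icc_succ_top (by omega), ← hg]
  ring

theorem qPoch_succ_eq_mul {n k : ℕ} (hk : k ≤ n) :
    qPoch (n + 1) = qPoch (n - k) * ∏ j ∈ range (k + 1), (1 - q ^ (n + 1 - j)) := by
  induction k with
  | zero => rw [qPoch_succ]; simp
  | succ k ih =>
    rw [ih (by omega), prod_range_succ _ (k + 1)]
    obtain ⟨m, rfl⟩ := Nat.exists_eq_add_of_le hk
    rw [show k + 1 + m - k = m + 1 by omega, qPoch_succ,
      show k + 1 + m - (k + 1) = m by omega, show k + 1 + m + 1 - (k + 1) = m + 1 by omega]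
    ring

theorem one_sub_q_pow_ne_zero (k : ℕ) : (1 - q ^ (k + 1) : Kq) ≠ 0 := by
  have := (map_ne_zero_iff (algebraMap (Polynomial ℚ) Kq)
    (IsFractionRing.injective _ _)).2 (one_sub_X_pow_ne_zero k)
  simpa using this

/-- Rescaling by (1-q)⋯(1-qⁿ) clears denominators: passing from index n - k to n + 1 contributes k +
1 consecutive factors, whose product absorbs 1 - q^{k+1}. -/
theorem IsNewton.hall {B : Type*} [CommRing B] [Algebra Kq B] {g : ℕ → B} {u : ℕ → B}
    (hu : IsNewton (fun _ k => (1 - q ^ (k + 1))⁻¹ • g k) u) :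
    IsNewton (fun n k => algebraMap (Polynomial ℚ) Kq (hallWeight n k) • g k)
      (fun n => qPoch n • u n) := by
  refine ⟨?_, fun n => ?_⟩
  · dsimp only
    rw [hu.1]
    simp [qPoch, qFactorial]
  · dsimp only
    rw [mul_smul_comm, hu.2, smul_sum]
    refine sum_congr rfl fun k hk => ?_
    have hk' : k ≤ n := Nat.lt_succ_iff.1 (mem_range.1 hk)
    rw [smul_mul_smul_comm, smul_mul_assoc, smul_smul]
    congr 1
    have h1 := congrArg (algebraMap (Polynomial ℚ) Kq) (hallWeight_mul n k)
    simp only [map_mul, map_sub, map_one, map_pow, map_prod, RatFunc.algebraMap_X] at h1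
    rw [qPoch_succ_eq_mul hk', ← h1]
    have := one_sub_q_pow_ne_zero k
    field_simp

/-- The sequence `n ↦ H_n[G]` for a series `G` with coefficients in `ℚ[q]`. -/
def hall (G : MvPowerSeries ℕ (Polynomial ℚ)) : ℕ → MvPowerSeries ℕ (Polynomial ℚ) :=
  newton fun n k => MvPowerSeries.C (hallWeight n k) * polyAdams k.succPNat G

theorem map_hall_eq (G : MvPowerSeries ℕ (Polynomial ℚ)) {u : ℕ → MvPowerSeries ℕ Kq}
    (hu : IsNewton (fun _ k => (1 - q ^ (k + 1))⁻¹ •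
      adams k.succPNat (MvPowerSeries.map (algebraMap _ Kq) G)) u) (n : ℕ) :
    qPoch n • u n = MvPowerSeries.map (algebraMap _ Kq) (hall G n) := by
  have h1 := (isNewton_newton (fun n k => MvPowerSeries.C (hallWeight n k) *
    polyAdams k.succPNat G)).map (MvPowerSeries.map (algebraMap (Polynomial ℚ) Kq))
  refine congrFun (hu.hall.unique (h1.congr fun n k _ => ?_)) n
  rw [map_mul, MvPowerSeries.map_C, ← adams_map, MvPowerSeries.smul_eq_C_mul]

/-- The expansion of `h_n` in the power sums. -/
def completePoly : ℕ → MvPolynomial ℕ+ Kq :=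
  newton fun _ k => MvPolynomial.X k.succPNat

theorem isNewton_aeval_completePoly {B : Type*} [CommRing B] [Algebra Kq B] (f : ℕ+ → B) :
    IsNewton (fun _ k => f k.succPNat) (fun n => MvPolynomial.aeval f (completePoly n)) := by
  have := (isNewton_newton fun _ k : ℕ =>
    (MvPolynomial.X k.succPNat : MvPolynomial ℕ+ Kq)).map (MvPolynomial.aeval f).toRingHom
  simpa [completePoly] using this

theorem aeval_p_completePoly (n : ℕ) :
    MvPolynomial.aeval (fun k : ℕ+ => p (k : ℕ)) (completePoly n) =
      (h n : MvPowerSeries ℕ Kq) :=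
  congrFun ((isNewton_aeval_completePoly fun k : ℕ+ =>
    (p (k : ℕ) : MvPowerSeries ℕ Kq)).unique isNewton_h) n

theorem H_eq_aeval (n : ℕ) :
    H n = MvPolynomial.aeval (fun k : ℕ+ => p (k : ℕ)) (qPoch n •
      MvPolynomial.aeval (fun k : ℕ+ => (1 - q ^ (k : ℕ))⁻¹ •
        (MvPolynomial.X k : MvPolynomial ℕ+ Kq)) (completePoly n)) := by
  rw [H, ← aeval_p_completePoly, plethysm_aeval, map_smul, ← qPoch, ← AlgHom.comp_apply,
    MvPolynomial.comp_aeval]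
  congr 3
  funext k
  rw [adams_smul, adams_p_one, map_smul, MvPolynomial.aeval_X, map_inv₀, map_sub, map_one, qPow_q]

theorem plethysm_H (n : ℕ) (g : MvPowerSeries ℕ Kq) :
    plethysm (H n) g = qPoch n • MvPolynomial.aeval
      (fun k : ℕ+ => (1 - q ^ (k : ℕ))⁻¹ • adams k g) (completePoly n) := by
  rw [H_eq_aeval, plethysm_aeval, map_smul, ← AlgHom.comp_apply, MvPolynomial.comp_aeval]
  simp only [map_smul, MvPolynomial.aeval_X]

/-- This keeps iterated plethysms inside the series over ℚ[q], where reduction modulo powers of 1 -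
q makes sense. -/
theorem plethysm_H_map (n : ℕ) (G : MvPowerSeries ℕ (Polynomial ℚ)) :
    plethysm (H n) (MvPowerSeries.map (algebraMap _ Kq) G) =
      MvPowerSeries.map (algebraMap _ Kq) (hall G n) := by
  rw [plethysm_H]
  exact map_hall_eq G (isNewton_aeval_completePoly fun k : ℕ+ => (1 - q ^ (k : ℕ))⁻¹ •
    adams k (MvPowerSeries.map (algebraMap _ Kq) G)) n

theorem H_eq_map (n : ℕ) : H n = MvPowerSeries.map (algebraMap _ Kq) (hall (p 1) n) := by
  rw [← plethysm_H_map, plethysm_H, H_eq_aeval, map_smul, ← AlgHom.comp_apply,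
    MvPolynomial.comp_aeval, map_p]
  simp only [map_smul, MvPolynomial.aeval_X, adams_p_one]

end HallLittlewood

/-! ### The recursion modulo (1-q)². -/

section SquareZero

theorem one_sub_X_mul_geom (m : ℕ) :
    (1 - Polynomial.X) * ∑ i ∈ range m, Polynomial.X ^ i = (1 - Polynomial.X ^ m : Polynomial ℚ) :=
  mul_neg_geom_sum _ m

/-- Cancelling one factor 1 - q exposes the power (1-q)^k. The geometric sum on the left takes the
value k + 1 at q = 1, so it becomes invertible modulo (1-q)². -/
theorem hallWeight_mul_geom (n k : ℕ) :
    hallWeight n k * ∑ i ∈ range (k + 1), Polynomial.X ^ i =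
      (1 - Polynomial.X) ^ k *
        ∏ j ∈ range (k + 1), ∑ i ∈ range (n + 1 - j), (Polynomial.X : Polynomial ℚ) ^ i := by
  have h0 : (1 - Polynomial.X : Polynomial ℚ) ≠ 0 := by simpa using one_sub_X_pow_ne_zero 0
  apply mul_left_cancel₀ h0
  rw [mul_left_comm, one_sub_X_mul_geom, hallWeight_mul, ← mul_assoc, ← pow_succ']
  simp only [← one_sub_X_mul_geom, prod_mul_distrib, prod_const, card_range]

theorem add_mul_pow_of_sq_eq_zero {B : Type*} [CommRing B] {τ : B} (hτ : τ ^ 2 = 0) (u v : B) (n : ℕ) :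
    (u + τ * v) ^ n = u ^ n + n * τ * v * u ^ (n - 1) := by
  induction n with
  | zero => simp
  | succ n ih =>
    rw [pow_succ, ih]
    cases n with
    | zero => simp
    | succ n =>
      simp only [Nat.add_sub_cancel]
      push_cast
      linear_combination ((n : B) + 1) * v ^ 2 * u ^ n * hτ

variable {B : Type*} [CommRing B] [Algebra ℚ B]

theorem four_mul_algebraMap_quarter : (4 : B) * algebraMap ℚ B (1 / 4) = 1 := by
  rw [← map_ofNat (algebraMap ℚ B) 4, ← map_mul]
  norm_num

variable {φ : Polynomial ℚ →+* B} (hφ : φ (1 - Polynomial.X) ^ 2 = 0)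

include hφ

omit [Algebra ℚ B] in
theorem map_X_pow_of_sq_eq_zero (i : ℕ) :
    φ (Polynomial.X ^ i) = 1 - i * φ (1 - Polynomial.X) := by
  have h1 := add_mul_pow_of_sq_eq_zero hφ 1 (-1) i
  rw [one_pow, one_pow] at h1
  rw [map_pow, show φ Polynomial.X = 1 + φ (1 - Polynomial.X) * (-1) by rw [map_sub, map_one]; ring,
    h1]
  ring

omit [Algebra ℚ B] in
theorem two_mul_map_geom_of_sq_eq_zero (m : ℕ) :
    2 * φ (∑ i ∈ range m, Polynomial.X ^ i) =
      2 * m - φ (1 - Polynomial.X) * (m * (m - 1)) := by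
  induction m with
  | zero => simp
  | succ m ih =>
    rw [sum_range_succ, map_add, mul_add, ih, map_X_pow_of_sq_eq_zero hφ]
    push_cast
    ring

theorem map_mul_geom_of_sq_eq_zero (m : ℕ) :
    φ (1 - Polynomial.X) * φ (∑ i ∈ range m, Polynomial.X ^ i) = m * φ (1 - Polynomial.X) := by
  have h4 := four_mul_algebraMap_quarter (B := B)
  have h2 := two_mul_map_geom_of_sq_eq_zero hφ m
  linear_combination 2 * algebraMap ℚ B (1 / 4) * φ (1 - Polynomial.X) * h2 -
    2 * algebraMap ℚ B (1 / 4) * (m * (m - 1)) * hφ -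
    (φ (1 - Polynomial.X) * φ (∑ i ∈ range m, Polynomial.X ^ i) - m * φ (1 - Polynomial.X)) * h4

theorem map_hallWeight_zero (n : ℕ) :
    φ (hallWeight n 0) =
      (n + 1 : ℕ) - 2 * algebraMap ℚ B (1 / 4) * φ (1 - Polynomial.X) * ((n + 1) * n) := by
  have h4 := four_mul_algebraMap_quarter (B := B)
  have h1 := hallWeight_mul_geom n 0
  simp only [zero_add, range_one, sum_singleton, pow_zero, mul_one, prod_singleton, one_mul,
    Nat.sub_zero] at h1
  have h2 := two_mul_map_geom_of_sq_eq_zero hφ (n + 1)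
  rw [h1]
  push_cast at h2 ⊢
  linear_combination 2 * algebraMap ℚ B (1 / 4) * h2 -
    (φ (∑ i ∈ range (n + 1), Polynomial.X ^ i) - (n + 1)) * h4

theorem map_hallWeight_one (n : ℕ) :
    φ (hallWeight n 1) =
      2 * algebraMap ℚ B (1 / 4) * φ (1 - Polynomial.X) * ((n + 1) * n) := by
  have h4 := four_mul_algebraMap_quarter (B := B)
  have h1 := congrArg φ (hallWeight_mul_geom n 1)
  simp only [prod_range_succ, prod_range_zero, one_mul, pow_one, map_mul, Nat.sub_zero,
    Nat.add_sub_cancel, ← mul_assoc] at h1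
  rw [map_mul_geom_of_sq_eq_zero hφ, mul_assoc _ (φ (1 - Polynomial.X)),
    map_mul_geom_of_sq_eq_zero hφ] at h1
  have h3 : φ (∑ i ∈ range (1 + 1), Polynomial.X ^ i) = 2 - φ (1 - Polynomial.X) := by
    rw [sum_range_succ, sum_range_one, map_add, map_X_pow_of_sq_eq_zero hφ,
      map_X_pow_of_sq_eq_zero hφ]
    push_cast
    ring
  rw [h3] at h1
  push_cast at h1
  have h5 : φ (hallWeight n 1) * φ (1 - Polynomial.X) = 0 := by
    linear_combination 2 * algebraMap ℚ B (1 / 4) * φ (1 - Polynomial.X) * h1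
      + 2 * algebraMap ℚ B (1 / 4) * (φ (hallWeight n 1) + (n + 1) * n) * hφ
      - φ (hallWeight n 1) * φ (1 - Polynomial.X) * h4
  linear_combination 2 * algebraMap ℚ B (1 / 4) * h1 + 2 * algebraMap ℚ B (1 / 4) * h5
    - φ (hallWeight n 1) * h4

theorem map_hallWeight_add_two (n k : ℕ) : φ (hallWeight n (k + 2)) = 0 := by
  have h1 := congrArg φ (hallWeight_mul_geom n (k + 2))
  rw [map_mul, map_mul, map_pow, pow_add, hφ, mul_zero, zero_mul] at h1
  have h2 := two_mul_map_geom_of_sq_eq_zero hφ (k + 2 + 1)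
  set τ := φ (1 - Polynomial.X)
  set g := φ (∑ i ∈ range (k + 2 + 1), Polynomial.X ^ i)
  set w := φ (hallWeight n (k + 2))
  set m : B := ((k + 2 + 1 : ℕ) : B) with hm
  -- The geometric sum is k + 3 up to a multiple of τ. Multiplying by τ removes that error and gives
  -- τw = 0; this then removes it from the original relation.
  have h3 : τ * w = 0 := by
    apply natCast_succ_mul_cancel (n := k + 2)
    have h4 := four_mul_algebraMap_quarter (B := B)
    rw [mul_zero]
    linear_combination 2 * algebraMap ℚ B (1 / 4) * (2 * τ * h1 - τ * w * h2 + w * (m * (m - 1)) * hφ)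
      - m * τ * w * h4
  apply natCast_succ_mul_cancel (n := k + 2)
  have h4 := four_mul_algebraMap_quarter (B := B)
  rw [mul_zero]
  linear_combination 2 * algebraMap ℚ B (1 / 4) * (2 * h1 - w * h2 + (m * (m - 1)) * h3)
    - m * w * h4

/-- Modulo `(1 - q)²`, the recursion for `n ↦ H_n[G]` has an explicit solution. -/
theorem isNewton_of_sq_eq_zero (f : ℕ → B) :
    IsNewton (fun n k => φ (hallWeight n k) * f k) (fun n => f 0 ^ n -
      algebraMap ℚ B (1 / 4) * (n * (n - 1)) * φ (1 - Polynomial.X) *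
        (f 0 ^ 2 - f 1) * f 0 ^ (n - 2)) := by
  refine ⟨by simp, fun n => ?_⟩
  rcases n with _ | n
  · simp [map_hallWeight_zero hφ]
  · dsimp only
    rw [sum_range_succ', sum_range_succ', sum_eq_zero fun k _ => by
      rw [map_hallWeight_add_two hφ, zero_mul, zero_mul]]
    rw [map_hallWeight_zero hφ, zero_add, map_hallWeight_one hφ]
    have h4 := four_mul_algebraMap_quarter (B := B)
    set τ := φ (1 - Polynomial.X)
    set κ := algebraMap ℚ B (1 / 4)
    rcases n with _ | n
    · simp only [zero_add, Nat.reduceAdd, Nat.reduceSub, Nat.sub_self]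
      push_cast
      ring
    · simp only [show n + 1 + 1 + 1 - 2 = n + 1 by omega,
        show n + 1 + 1 - (0 + 1) = n + 1 by omega, Nat.sub_zero]
      push_cast
      -- What remains is quadratic in τ: products of a first-order term of a weight with a
      -- first-order term of the proposed solution.
      linear_combination (-2 * κ ^ 2 * (n + 3) * (n + 2) * (n + 2) * (n + 1) *
        (f 0 ^ 2 - f 1) * f 0 ^ (n + 1) + 2 * κ ^ 2 * (n + 3) * (n + 2) * (n + 1) * n *
        f 1 * (f 0 ^ 2 - f 1) * f 0 ^ (n - 1)) * hφ

end SquareZero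

/-! ### First-order expansion of the commutator and its value at q = 1. -/

section ValueAtOne

theorem polyAdams_one (G : MvPowerSeries ℕ (Polynomial ℚ)) : polyAdams (Nat.succPNat 0) G = G := by
  have h1 : (Polynomial.expand ℚ 1).toRingHom = RingHom.id (Polynomial ℚ) :=
    RingHom.ext fun f => Polynomial.expand_one f
  change MvPowerSeries.expand 1 one_ne_zero
    (MvPowerSeries.map (Polynomial.expand ℚ 1).toRingHom G) = G
  rw [h1, MvPowerSeries.map_id, MvPowerSeries.expand_one_apply]
  rfl

/-- The series `1 - q`. -/
def oneSubQ : MvPowerSeries ℕ (Polynomial ℚ) := MvPowerSeries.C (1 - Polynomial.X)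

/-- The power series over `ℚ[q]` modulo `(1 - q)²`. -/
abbrev FirstOrder : Type :=
  MvPowerSeries ℕ (Polynomial ℚ) ⧸ Ideal.span {oneSubQ ^ 2}

/-- The reduction modulo `(1 - q)²`. -/
def toFirstOrder : MvPowerSeries ℕ (Polynomial ℚ) →+* FirstOrder := Ideal.Quotient.mk _

theorem toFirstOrder_eq_zero_iff {f : MvPowerSeries ℕ (Polynomial ℚ)} :
    toFirstOrder f = 0 ↔ oneSubQ ^ 2 ∣ f := by
  rw [toFirstOrder, Ideal.Quotient.eq_zero_iff_mem, Ideal.mem_span_singleton]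

theorem toFirstOrder_oneSubQ_sq : toFirstOrder oneSubQ ^ 2 = 0 := by
  rw [← map_pow, toFirstOrder_eq_zero_iff]

theorem toFirstOrder_hall (G : MvPowerSeries ℕ (Polynomial ℚ)) (n : ℕ) :
    toFirstOrder (hall G n) = toFirstOrder G ^ n -
      algebraMap ℚ FirstOrder (1 / 4) * (n * (n - 1)) * toFirstOrder oneSubQ *
        (toFirstOrder G ^ 2 - toFirstOrder (polyAdams 2 G)) * toFirstOrder G ^ (n - 2) := by
  have h1 := (isNewton_newton fun n k =>
    MvPowerSeries.C (hallWeight n k) * polyAdams k.succPNat G).map toFirstOrder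
  have h2 := isNewton_of_sq_eq_zero (φ := toFirstOrder.comp MvPowerSeries.C)
    toFirstOrder_oneSubQ_sq (fun k => toFirstOrder (polyAdams k.succPNat G))
  have h3 := congrFun ((h1.congr fun n k _ => by rw [map_mul]; rfl).unique h2) n
  rw [polyAdams_one] at h3
  exact h3

theorem toFirstOrder_oneSubQ_mul_eq_of_dvd {f g : MvPowerSeries ℕ (Polynomial ℚ)}
    (hfg : oneSubQ ∣ f - g) :
    toFirstOrder oneSubQ * toFirstOrder f = toFirstOrder oneSubQ * toFirstOrder g := by
  rw [← sub_eq_zero, ← mul_sub, ← map_sub, ← map_mul, toFirstOrder_eq_zero_iff, pow_two]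
  exact mul_dvd_mul_left _ hfg

theorem oneSubQ_dvd_hall_sub (G : MvPowerSeries ℕ (Polynomial ℚ)) (n : ℕ) :
    oneSubQ ∣ hall G n - G ^ n := by
  set s := (algebraMap ℚ (MvPowerSeries ℕ (Polynomial ℚ)) (1 / 4) * (n * (n - 1))) *
    (G ^ 2 - polyAdams 2 G) * G ^ (n - 2) with hs
  have h1 : oneSubQ ^ 2 ∣ (hall G n - G ^ n) + oneSubQ * s := by
    rw [← toFirstOrder_eq_zero_iff, map_add, map_sub, toFirstOrder_hall, hs]
    simp only [map_mul, map_sub, map_pow, map_natCast, map_one, RingHom.map_rat_algebraMap]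
    ring
  have h2 := dvd_trans (dvd_pow_self oneSubQ two_ne_zero) h1
  exact (dvd_add_left (dvd_mul_right _ _)).1 h2

/-- Since p_k[1-q] = 1 - q^k, the plethysm by p_k preserves congruences modulo 1 - q. -/
theorem oneSubQ_dvd_polyAdams (k : ℕ+) : oneSubQ ∣ polyAdams k oneSubQ := by
  rw [polyAdams, RingHom.comp_apply, oneSubQ, MvPowerSeries.map_C, AlgHom.toRingHom_eq_coe,
    RingHom.coe_coe, MvPowerSeries.expand_C]
  apply map_dvd
  simp only [AlgHom.toRingHom_eq_coe, RingHom.coe_coe, map_sub, map_one, Polynomial.expand_X]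
  exact one_sub_dvd_one_sub_pow _ _

/-- The leading term H_a^b needs the inner H_a to first order. The outer correction already carries
1 - q, so there H_a and p_2[H_a] may be replaced by p_1^a and p_2^a. -/
theorem toFirstOrder_hall_hall (a b : ℕ) :
    toFirstOrder (hall (hall (p 1) a) b) = toFirstOrder (p 1) ^ (a * b) -
      algebraMap ℚ FirstOrder (1 / 4) * toFirstOrder oneSubQ *
      (b * (a * (a - 1)) * (toFirstOrder (p 1) ^ 2 - toFirstOrder (p 2)) *
          (toFirstOrder (p 1) ^ (a - 2) * toFirstOrder (p 1) ^ (a * (b - 1))) +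
        b * (b - 1) * (toFirstOrder (p 1) ^ (2 * a) - toFirstOrder (p 2) ^ a) *
          toFirstOrder (p 1) ^ (a * (b - 2))) := by
  have hG := toFirstOrder_hall (p 1) a
  have hτ := toFirstOrder_oneSubQ_sq
  have h1 := toFirstOrder_oneSubQ_mul_eq_of_dvd (oneSubQ_dvd_hall_sub (p 1) a)
  have h2 : toFirstOrder oneSubQ * toFirstOrder (polyAdams 2 (hall (p 1) a)) =
      toFirstOrder oneSubQ * toFirstOrder (p 2) ^ a := by
    rw [← map_pow]
    apply toFirstOrder_oneSubQ_mul_eq_of_dvd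
    have h3 := map_dvd (polyAdams 2) (oneSubQ_dvd_hall_sub (p 1) a)
    rw [map_sub, map_pow, polyAdams_p_one] at h3
    exact dvd_trans (oneSubQ_dvd_polyAdams 2) h3
  rw [polyAdams_p_one, PNat.val_ofNat] at hG
  rw [map_pow] at h1
  have h5 : ∀ m, toFirstOrder oneSubQ * toFirstOrder (hall (p 1) a) ^ m =
      toFirstOrder oneSubQ * toFirstOrder (p 1) ^ (a * m) := by
    intro m
    rw [pow_mul (toFirstOrder (p 1))]
    induction m with
    | zero => simp
    | succ m ih =>
      linear_combination toFirstOrder (hall (p 1) a) * ih + (toFirstOrder (p 1) ^ a) ^ m * h1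
  have h6 : toFirstOrder (hall (p 1) a) ^ b = toFirstOrder (p 1) ^ (a * b) -
      algebraMap ℚ FirstOrder (1 / 4) * toFirstOrder oneSubQ *
      (b * (a * (a - 1)) * (toFirstOrder (p 1) ^ 2 - toFirstOrder (p 2)) *
          (toFirstOrder (p 1) ^ (a - 2) * toFirstOrder (p 1) ^ (a * (b - 1)))) := by
    rw [hG, sub_eq_add_neg, show -(algebraMap ℚ FirstOrder (1 / 4) * (a * (a - 1)) *
        toFirstOrder oneSubQ * (toFirstOrder (p 1) ^ 2 - toFirstOrder (p 2)) *
        toFirstOrder (p 1) ^ (a - 2)) = toFirstOrder oneSubQ * (-(algebraMap ℚ FirstOrder (1 / 4) *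
        (a * (a - 1)) * (toFirstOrder (p 1) ^ 2 - toFirstOrder (p 2)) *
        toFirstOrder (p 1) ^ (a - 2))) by ring, add_mul_pow_of_sq_eq_zero hτ, ← pow_mul, ← pow_mul]
    ring
  rw [toFirstOrder_hall, h6]
  have h7 := h5 (b - 2)
  have h8 := h5 2
  rw [mul_comm a 2] at h8
  linear_combination -algebraMap ℚ FirstOrder (1 / 4) * (b * (b - 1)) *
    (toFirstOrder (hall (p 1) a) ^ (b - 2) * (h8 - h2) +
      (toFirstOrder (p 1) ^ (2 * a) - toFirstOrder (p 2) ^ a) * h7)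

/-- The value of `F a b` at `q = 1` in terms of `x = p₁` and `y = p₂`. -/
def valueAtOne {B : Type*} [CommRing B] [Algebra ℚ B] (x y : B) (a b : ℕ) : B :=
  algebraMap ℚ B (1 / 4) *
    (a * b * (b - a) * (x ^ 2 - y) * x ^ (a * b - 2)
      + a * (a - 1) * (x ^ ((a - 2) * b) * (x ^ (2 * b) - y ^ b))
      - b * (b - 1) * (x ^ (a * (b - 2)) * (x ^ (2 * a) - y ^ a)))

theorem map_valueAtOne {A B : Type*} [CommRing A] [Algebra ℚ A] [CommRing B] [Algebra ℚ B]
    (f : A →+* B) (x y : A) (a b : ℕ) :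
    f (valueAtOne x y a b) = valueAtOne (f x) (f y) a b := by
  simp only [valueAtOne, map_mul, map_add, map_sub, map_pow, map_natCast, map_one,
    RingHom.map_rat_algebraMap]

theorem toFirstOrder_commutator {a b : ℕ} (ha : 1 < a) (hb : 1 < b) :
    toFirstOrder (hall (hall (p 1) a) b - hall (hall (p 1) b) a) =
      toFirstOrder (oneSubQ * valueAtOne (p 1) (p 2) a b) := by
  obtain ⟨a, rfl⟩ := Nat.exists_eq_add_of_le' ha
  obtain ⟨b, rfl⟩ := Nat.exists_eq_add_of_le' hb
  rw [map_sub, toFirstOrder_hall_hall, toFirstOrder_hall_hall, map_mul, map_valueAtOne, valueAtOne,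
    show (a + 1 + 1) * (b + 1 + 1) - 2 = a + (a + 1 + 1) * (b + 1) by ring_nf; omega]
  simp only [show a + 1 + 1 - 2 = a by omega, show b + 1 + 1 - 2 = b by omega]
  push_cast
  ring

theorem hasValueAt_F {a b : ℕ} (ha : 1 < a) (hb : 1 < b) :
    HasValueAt (F a b) 1 (valueAtOne (p 1) (p 2) a b) := by
  have h1 := toFirstOrder_commutator ha hb
  rw [← sub_eq_zero, ← map_sub, toFirstOrder_eq_zero_iff] at h1
  -- The commutator is (1-q) times the value plus (1-q)² r; dividing by 1 - q leaves an error
  -- vanishing at q = 1.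
  obtain ⟨r, hr⟩ := h1
  refine ⟨valueAtOne (p 1) (p 2) a b + oneSubQ * r, ?_, ?_⟩
  · have hp : ∀ c d, plethysm (H d) (H c) =
        MvPowerSeries.map (algebraMap _ Kq) (hall (hall (p 1) c) d) := fun c d => by
      rw [← plethysm_H_map, ← H_eq_map]
    rw [F, hp, hp, ← map_sub, show hall (hall (p 1) a) b - hall (hall (p 1) b) a =
        oneSubQ * (valueAtOne (p 1) (p 2) a b + oneSubQ * r) by linear_combination hr]
    generalize valueAtOne (p 1) (p 2) a b + oneSubQ * r = v
    rw [map_mul, oneSubQ, MvPowerSeries.map_C, ← MvPowerSeries.smul_eq_C_mul, smul_smul, map_sub, map_one,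
      RatFunc.algebraMap_X, inv_mul_cancel₀, one_smul]
    simpa using one_sub_q_pow_ne_zero 0
  · rw [map_add, map_mul, map_valueAtOne, map_p, map_p, oneSubQ, MvPowerSeries.map_C]
    simp

theorem h_one {R : Type*} [CommRing R] : (h 1 : MvPowerSeries ℕ R) = p 1 := by
  have h1 := isNewton_h (R := R)
  have h2 := h1.2 0
  rw [zero_add, sum_range_one, h1.1] at h2
  simpa using h2

theorem p_two {R : Type*} [CommRing R] : (p 2 : MvPowerSeries ℕ R) = h 2 - e 2 := by
  classical
  rw [eq_sub_iff_add_eq]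
  ext m
  rw [map_add, coeff_h]
  change (if _ then _ else _) + (if _ then _ else _) = _
  by_cases h1 : ∃ i, m = Finsupp.single i 2
  · rw [if_pos h1]
    obtain ⟨i, rfl⟩ := h1
    rw [if_neg, add_zero, Finsupp.degree_single, if_pos rfl]
    rintro ⟨-, h2⟩
    have := h2 i
    rw [Finsupp.single_eq_same] at this
    omega
  · rw [if_neg h1, zero_add]
    refine if_congr ⟨And.left, fun hm => ⟨hm, fun i => ?_⟩⟩ rfl rfl
    by_contra! hi
    apply h1
    refine ⟨i, ?_⟩
    have hle : Finsupp.single i 2 ≤ m := Finsupp.single_le_iff.2 hi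
    have h3 := congrArg Finsupp.degree (tsub_add_cancel_of_le hle)
    rw [map_add, Finsupp.degree_single, hm] at h3
    have h4 : m - Finsupp.single i 2 = 0 := by
      rw [← Finsupp.degree_eq_zero_iff]
      omega
    rw [tsub_eq_zero_iff_le] at h4
    exact le_antisymm h4 hle

theorem h_one_sq : (h 1 : MvPowerSeries ℕ ℚ) ^ 2 = h 2 + e 2 := by
  have h1 := isNewton_h (R := ℚ)
  have h2 := h1.2 1
  rw [sum_range_succ, sum_range_one, h1.1] at h2
  simp only [Nat.reduceAdd, Nat.sub_zero, ← h_one, p_two] at h2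
  push_cast at h2
  linear_combination -h2

theorem valueAtOne_eq (a b : ℕ) :
    (valueAtOne (p 1) (p 2) a b : MvPowerSeries ℕ ℚ) = (1 / 2 : ℚ) •
        (((a : ℚ) * b * ((b : ℚ) - a)) • (h 1 ^ (a * b - 2) * e 2)
          + ((a : ℚ) * ((a : ℚ) - 1)) • (h 1 ^ ((a - 2) * b) * oddPart b)
          - ((b : ℚ) * ((b : ℚ) - 1)) • (h 1 ^ (a * (b - 2)) * oddPart a)) := by
  have h4 := four_mul_algebraMap_quarter (B := MvPowerSeries ℕ ℚ)
  have h2 : algebraMap ℚ (MvPowerSeries ℕ ℚ) (1 / 2) =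
      2 * algebraMap ℚ (MvPowerSeries ℕ ℚ) (1 / 4) := by
    rw [← map_ofNat (algebraMap ℚ (MvPowerSeries ℕ ℚ)) 2, ← map_mul]
    norm_num
  simp only [valueAtOne, oddPart, Algebra.smul_def, h2, map_mul, map_sub, map_natCast, map_one,
    ← h_one, p_two, pow_mul (h 1 : MvPowerSeries ℕ ℚ) 2, h_one_sq]
  set κ := algebraMap ℚ (MvPowerSeries ℕ ℚ) (1 / 4)
  linear_combination (-κ * (a * (a - 1) * (h 1 ^ ((a - 2) * b) * ((h 2 + e 2) ^ b - (h 2 - e 2) ^ b))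
    - b * (b - 1) * (h 1 ^ (a * (b - 2)) * ((h 2 + e 2) ^ a - (h 2 - e 2) ^ a)))) * h4

end ValueAtOne

/-! ### Nonnegativity and integrality of the coefficients in h_2 and e_2. -/

section Positivity

variable {A : Type*} [CommRing A] [Algebra ℚ A]

/-- The part of `(x + y)^n` that is odd in `y`. -/
def oddPow (x y : A) (n : ℕ) : A := algebraMap ℚ A (1 / 2) * ((x + y) ^ n - (x - y) ^ n)

/-- The part of `(x + y)^n` that is even in `y`. -/
def evenPow (x y : A) (n : ℕ) : A := algebraMap ℚ A (1 / 2) * ((x + y) ^ n + (x - y) ^ n)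

theorem two_mul_algebraMap_half : (2 : A) * algebraMap ℚ A (1 / 2) = 1 := by
  rw [← map_ofNat (algebraMap ℚ A) 2, ← map_mul]
  norm_num

theorem oddPow_succ (x y : A) (n : ℕ) :
    oddPow x y (n + 1) = x * oddPow x y n + y * evenPow x y n := by
  rw [oddPow, oddPow, evenPow]
  ring

theorem evenPow_succ (x y : A) (n : ℕ) :
    evenPow x y (n + 1) = x * evenPow x y n + y * oddPow x y n := by
  rw [evenPow, oddPow, evenPow]
  ring

theorem oddPow_mem {T : Subsemiring A} {x y : A} (hx : x ∈ T) (hy : y ∈ T) (n : ℕ) :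
    oddPow x y n ∈ T ∧ evenPow x y n ∈ T := by
  induction n with
  | zero =>
    have h1 : evenPow x y 0 = 1 := by
      rw [evenPow]
      linear_combination two_mul_algebraMap_half (A := A)
    rw [h1, oddPow, pow_zero, pow_zero, sub_self, mul_zero]
    exact ⟨T.zero_mem, T.one_mem⟩
  | succ n ih =>
    rw [oddPow_succ, evenPow_succ]
    exact ⟨add_mem (mul_mem hx ih.1) (mul_mem hy ih.2),
      add_mem (mul_mem hx ih.2) (mul_mem hy ih.1)⟩

/-- Expanding each product in powers of x + y and x - y leaves geometric sums; the factor y clears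
their denominator (x+y) - (x-y) = 2y. -/
theorem sum_oddPow_mul_oddPow (x y : A) (n : ℕ) :
    4 * y * ∑ i ∈ range (n + 1), oddPow x y (i + 1) * oddPow x y (n - i + 1) =
      (n + 1) * oddPow x y (n + 3) - (n + 3) * (x + y) * oddPow x y (n + 2)
        + (n + 3) * (x + y) ^ (n + 2) * y := by
  have h2 := two_mul_algebraMap_half (A := A)
  have hterm : ∀ i ∈ range (n + 1), 4 * (oddPow x y (i + 1) * oddPow x y (n - i + 1)) =
      ((x + y) ^ (n + 2) + (x - y) ^ (n + 2)) -
      (x + y) * (x - y) * ((x + y) ^ i * (x - y) ^ (n - i)) -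
      (x + y) * (x - y) * ((x - y) ^ i * (x + y) ^ (n - i)) := by
    intro i hi
    obtain ⟨j, rfl⟩ := Nat.exists_eq_add_of_le (Nat.lt_succ_iff.1 (mem_range.1 hi))
    rw [Nat.add_sub_cancel_left, oddPow, oddPow]
    linear_combination (((x + y) ^ (i + 1) - (x - y) ^ (i + 1)) *
      ((x + y) ^ (j + 1) - (x - y) ^ (j + 1))) * (2 * algebraMap ℚ A (1 / 2) + 1) * h2
  have hg1 := (Commute.all (x + y) (x - y)).geom_sum₂_mul (n + 1)
  have hg2 := (Commute.all (x - y) (x + y)).geom_sum₂_mul (n + 1)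
  simp only [Nat.add_sub_cancel] at hg1 hg2
  have hsum := sum_congr rfl hterm
  rw [← mul_sum, sum_sub_distrib, sum_sub_distrib, sum_const, card_range, nsmul_eq_mul,
    ← mul_sum, ← mul_sum] at hsum
  rw [oddPow, oddPow, mul_right_comm, hsum]
  push_cast
  set S₁ := ∑ i ∈ range (n + 1), (x + y) ^ i * (x - y) ^ (n - i)
  set S₂ := ∑ i ∈ range (n + 1), (x - y) ^ i * (x + y) ^ (n - i)
  have h3 : y * (S₁ + S₂) = (x + y) ^ (n + 1) - (x - y) ^ (n + 1) := by
    linear_combination algebraMap ℚ A (1 / 2) * (hg1 - hg2) -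
      (y * (S₁ + S₂) - ((x + y) ^ (n + 1) - (x - y) ^ (n + 1))) * h2
  linear_combination -((x + y) * (x - y)) * h3 -
    ((n + 1) * ((x + y) ^ (n + 2) + (x - y) ^ (n + 2)) * y - (x + y) * (x - y) *
      ((x + y) ^ (n + 1) - (x - y) ^ (n + 1)) - (n + 3) * (x + y) ^ (n + 2) * y) * h2

/-- A normalisation of `O_n - n (x + y)^{n-1} y`, where `O_n` is the part of `(x + y)^n` that is
odd in `y`. -/
def oddDefect (x y : A) (n : ℕ) : A :=
  algebraMap ℚ A (1 / (n * (n - 1))) * (oddPow x y n - n * (x + y) ^ (n - 1) * y)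

/-- The normalisation of `oddDefect` is chosen so that this difference is visibly nonnegative. -/
theorem oddDefect_succ_sub (x y : A) (n : ℕ) :
    oddDefect x y (n + 3) - (x + y) * oddDefect x y (n + 2) =
      algebraMap ℚ A (4 / ((n + 3) * (n + 2) * (n + 1))) *
        (y * ∑ i ∈ range (n + 1), oddPow x y (i + 1) * oddPow x y (n - i + 1)) := by
  have hn1 : (n + 1 : ℚ) ≠ 0 := by positivity
  have hn2 : (n + 2 : ℚ) ≠ 0 := by positivity
  have hn3 : (n + 3 : ℚ) ≠ 0 := by positivity
  set c := algebraMap ℚ A (1 / ((n + 3) * (n + 2) * (n + 1))) with hc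
  have h1 : algebraMap ℚ A (1 / ((n + 3 : ℕ) * ((n + 3 : ℕ) - 1))) = (n + 1) * c := by
    rw [hc, ← map_natCast (algebraMap ℚ A) n, ← map_one (algebraMap ℚ A), ← map_add, ← map_mul]
    congr 1
    push_cast
    rw [show (n + 3 - 1 : ℚ) = n + 2 by ring]
    field_simp
  have h2 : algebraMap ℚ A (1 / ((n + 2 : ℕ) * ((n + 2 : ℕ) - 1))) = (n + 3) * c := by
    rw [hc, ← map_natCast (algebraMap ℚ A) n, ← map_ofNat (algebraMap ℚ A) 3, ← map_add, ← map_mul]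
    congr 1
    push_cast
    rw [show (n + 2 - 1 : ℚ) = n + 1 by ring]
    field_simp
  have h3 : algebraMap ℚ A (4 / ((n + 3) * (n + 2) * (n + 1))) = 4 * c := by
    rw [hc, ← map_ofNat (algebraMap ℚ A) 4, ← map_mul]
    congr 1
    ring
  rw [oddDefect, oddDefect, h1, h2, h3]
  have h4 := sum_oddPow_mul_oddPow x y n
  simp only [show n + 3 - 1 = n + 2 by omega, show n + 2 - 1 = n + 1 by omega]
  push_cast
  linear_combination -c * h4

theorem oddDefect_sub_mem {T : Subsemiring A} (hT : ∀ r : ℚ, 0 ≤ r → algebraMap ℚ A r ∈ T)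
    {x y : A} (hx : x ∈ T) (hy : y ∈ T) (n k : ℕ) :
    oddDefect x y (n + 2 + k) - (x + y) ^ k * oddDefect x y (n + 2) ∈ T := by
  induction k with
  | zero => simp
  | succ k ih =>
    have h1 : oddDefect x y (n + 2 + (k + 1)) - (x + y) ^ (k + 1) * oddDefect x y (n + 2) =
        (oddDefect x y (n + k + 3) - (x + y) * oddDefect x y (n + k + 2)) +
        (x + y) * (oddDefect x y (n + 2 + k) - (x + y) ^ k * oddDefect x y (n + 2)) := by
      rw [show n + 2 + (k + 1) = n + k + 3 by ring, show n + 2 + k = n + k + 2 by ring]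
      ring
    rw [h1, oddDefect_succ_sub]
    refine add_mem (mul_mem (hT _ (by positivity)) (mul_mem hy (sum_mem fun i _ => ?_)))
      (mul_mem (add_mem hx hy) ih)
    exact mul_mem (oddPow_mem hx hy _).1 (oddPow_mem hx hy _).1

/-- The value of `F a b` at `q = 1`, divided by `h₁^{(a-2)b}`, in terms of `x = h₂` and
`y = e₂`. -/
def reducedValue (x y : A) (a b : ℕ) : A :=
  algebraMap ℚ A (a * b * (b - a) / 2) * ((x + y) ^ (b - 1) * y)
    + algebraMap ℚ A (a * (a - 1) / 2) * oddPow x y b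
    - algebraMap ℚ A (b * (b - 1) / 2) * ((x + y) ^ (b - a) * oddPow x y a)

theorem reducedValue_eq (x y : A) (n k : ℕ) :
    reducedValue x y (n + 2) (n + 2 + k) =
      algebraMap ℚ A ((n + 2) * (n + 2 + k) * (n + 1) * (n + 1 + k) / 2) *
        (oddDefect x y (n + 2 + k) - (x + y) ^ k * oddDefect x y (n + 2)) := by
  have hn1 : (n + 1 : ℚ) ≠ 0 := by positivity
  have hn2 : (n + 2 : ℚ) ≠ 0 := by positivity
  have hn3 : (n + 2 + k : ℚ) ≠ 0 := by positivity
  have hn4 : (n + 1 + k : ℚ) ≠ 0 := by positivity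
  rw [reducedValue, oddDefect, oddDefect]
  simp only [show n + 2 + k - 1 = n + 1 + k by omega, show n + 2 - 1 = n + 1 by omega,
    show n + 2 + k - (n + 2) = k by omega]
  have h1 : ((n + 2) * (n + 2 + k) * (n + 1) * (n + 1 + k) / 2 : ℚ) *
      (1 / ((n + 2 + k : ℕ) * ((n + 2 + k : ℕ) - 1))) = (n + 2) * (n + 1) / 2 := by
    push_cast
    rw [show (n + 2 + k - 1 : ℚ) = n + 1 + k by ring]
    field_simp
  have h2 : ((n + 2) * (n + 2 + k) * (n + 1) * (n + 1 + k) / 2 : ℚ) *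
      (1 / ((n + 2 : ℕ) * ((n + 2 : ℕ) - 1))) = (n + 2 + k) * (n + 1 + k) / 2 := by
    push_cast
    rw [show (n + 2 - 1 : ℚ) = n + 1 by ring]
    field_simp
  have h3 := congrArg (algebraMap ℚ A) h1
  have h4 := congrArg (algebraMap ℚ A) h2
  rw [map_mul] at h3 h4
  generalize algebraMap ℚ A ((n + 2) * (n + 2 + k) * (n + 1) * (n + 1 + k) / 2) = d at h3 h4 ⊢
  generalize algebraMap ℚ A (1 / ((n + 2 + k : ℕ) * ((n + 2 + k : ℕ) - 1))) = c₁ at h3 ⊢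
  generalize algebraMap ℚ A (1 / ((n + 2 : ℕ) * ((n + 2 : ℕ) - 1))) = c₂ at h4 ⊢
  simp only [div_eq_mul_inv, map_mul, map_add, map_sub, map_natCast, map_ofNat, map_one]
    at h3 h4 ⊢
  push_cast
  linear_combination (x + y) ^ k * (oddPow x y (n + 2) - (n + 2) * (x + y) ^ (n + 1) * y) * h4 -
    (oddPow x y (n + 2 + k) - (n + 2 + k) * (x + y) ^ (n + 1 + k) * y) * h3

theorem reducedValue_mem {T : Subsemiring A} (hT : ∀ r : ℚ, 0 ≤ r → algebraMap ℚ A r ∈ T)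
    {x y : A} (hx : x ∈ T) (hy : y ∈ T) {a b : ℕ} (ha : 1 < a) (hab : a < b) :
    reducedValue x y a b ∈ T := by
  obtain ⟨n, rfl⟩ := Nat.exists_eq_add_of_le' ha
  obtain ⟨k, rfl⟩ := Nat.exists_eq_add_of_le hab.le
  rw [show n + Nat.succ 1 = n + 2 from rfl, reducedValue_eq]
  exact mul_mem (hT _ (by positivity)) (oddDefect_sub_mem hT hx hy n k)

theorem exists_int_mul_pred_div_two (n : ℕ) : ∃ z : ℤ, (z : ℚ) = n * (n - 1) / 2 := by
  refine ⟨n.choose 2, ?_⟩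
  rw [Int.cast_natCast, Nat.cast_choose_two]

theorem reducedValue_mem_of_int {T : Subring A} {x y : A} (hx : x ∈ T) (hy : y ∈ T) (a b : ℕ) :
    reducedValue x y a b ∈ T := by
  have hodd : ∀ n, oddPow x y n ∈ T := fun n =>
    (oddPow_mem (T := T.toSubsemiring) hx hy n).1
  have hint : ∀ r : ℚ, (∃ z : ℤ, (z : ℚ) = r) → algebraMap ℚ A r ∈ T := by
    rintro _ ⟨z, rfl⟩
    rw [map_intCast]
    exact intCast_mem T z
  have hs := add_mem hx hy
  refine sub_mem (add_mem (mul_mem (hint _ ?_) (mul_mem (pow_mem hs _) hy))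
    (mul_mem (hint _ (exists_int_mul_pred_div_two a)) (hodd b)))
    (mul_mem (hint _ (exists_int_mul_pred_div_two b)) (mul_mem (pow_mem hs _) (hodd a)))
  obtain ⟨u, hu⟩ := exists_int_mul_pred_div_two a
  obtain ⟨v, hv⟩ := exists_int_mul_pred_div_two b
  -- ab(b-a)/2 = a·C(b,2) - b·C(a,2).
  refine ⟨a * v - b * u, ?_⟩
  push_cast
  rw [hu, hv]
  ring

/-- Here z plays h_1. Every exponent of z exceeds (a-2)b by an even number, so the excess becomes a
power of x + y. -/
theorem valueAtOne_eq_reducedValue {z x y : A} (hz : z ^ 2 = x + y) {a b : ℕ} (ha : 1 < a)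
    (hab : a < b) :
    valueAtOne z (x - y) a b = z ^ ((a - 2) * b) * reducedValue x y a b := by
  obtain ⟨n, rfl⟩ := Nat.exists_eq_add_of_le' ha
  obtain ⟨k, rfl⟩ := Nat.exists_eq_add_of_le hab.le
  rw [valueAtOne, reducedValue, oddPow, oddPow]
  simp only [show n + Nat.succ 1 = n + 2 from rfl, show n + 2 + k - 1 = n + 1 + k by omega,
    show n + 2 + k - (n + 2) = k by omega, Nat.add_sub_cancel]
  rw [show (n + 2) * (n + 2 + k) - 2 = n * (n + 2 + k) + 2 * (n + 1 + k) by
      rw [show (n + 2) * (n + 2 + k) = n * (n + 2 + k) + 2 * (n + 1 + k) + 2 by ring]; omega,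
    show (n + 2) * (n + 2 + k - 2) = n * (n + 2 + k) + 2 * k by
      rw [show n + 2 + k - 2 = n + k by omega]; ring]
  simp only [pow_add z, pow_mul z 2, hz]
  have h2 : algebraMap ℚ A (1 / 4) = algebraMap ℚ A (1 / 2) * algebraMap ℚ A (1 / 2) := by
    rw [← map_mul]; norm_num
  have hhalf := two_mul_algebraMap_half (A := A)
  rw [h2]
  simp only [div_eq_mul_inv, map_mul, map_sub, map_natCast, map_one, one_mul]
    at hhalf ⊢
  push_cast
  linear_combination (algebraMap ℚ A 2⁻¹ * (n + 2) * (n + 2 + k) * k * (x + y) ^ (n + 1 + k) * y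
    * z ^ (n * (n + 2 + k))) * hhalf

end Positivity

/-! ### From nonnegative integral rational coefficients to coefficients in ℕ. -/

section NatPolynomial

open MvPolynomial

/-- The polynomials with nonnegative coefficients. -/
def nonnegCoeffs (σ : Type*) : Subsemiring (MvPolynomial σ ℚ) where
  carrier := {P | ∀ m, 0 ≤ coeff m P}
  mul_mem' {P Q} hP hQ m := by
    classical
    rw [coeff_mul]
    exact sum_nonneg fun x _ => mul_nonneg (hP _) (hQ _)
  one_mem' m := by
    classical
    rw [coeff_one]
    split_ifs <;> norm_num
  add_mem' {P Q} hP hQ m := by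
    rw [coeff_add]
    exact add_nonneg (hP _) (hQ _)
  zero_mem' m := by rw [coeff_zero]

theorem exists_nat_of_nonneg_of_int {σ : Type*} {P : MvPolynomial σ ℚ} (h0 : P ∈ nonnegCoeffs σ)
    (h1 : P ∈ (map (Int.castRingHom ℚ) : MvPolynomial σ ℤ →+* MvPolynomial σ ℚ).range) :
    ∃ Q : MvPolynomial σ ℕ, map (Nat.castRingHom ℚ) Q = P := by
  obtain ⟨Z, rfl⟩ := h1
  have h2 : map (Int.castRingHom ℚ) Z ∈ Set.range (map (Nat.castRingHom ℚ)) := by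
    rw [mem_range_map_iff_coeffs_subset]
    intro c hc
    rw [mem_coe, mem_coeffs_iff] at hc
    obtain ⟨m, -, rfl⟩ := hc
    have h3 := h0 m
    rw [coeff_map] at h3 ⊢
    simp only [eq_intCast, Int.cast_nonneg_iff] at h3 ⊢
    refine ⟨(coeff m Z).toNat, ?_⟩
    rw [Nat.coe_castRingHom, ← Int.cast_natCast, Int.toNat_of_nonneg h3]
  exact h2

theorem isNatPolynomial_valueAtOne {a b : ℕ} (ha : 1 < a) (hab : a < b) :
    IsNatPolynomial (valueAtOne (p 1) (p 2) a b) := by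
  have hX : ∀ i : Fin 3, (X i : MvPolynomial (Fin 3) ℚ) ∈ nonnegCoeffs (Fin 3) := by
    intro i m
    rw [coeff_X]
    split_ifs <;> norm_num
  have hX' : ∀ i : Fin 3, (X i : MvPolynomial (Fin 3) ℚ) ∈
      (map (Int.castRingHom ℚ) : MvPolynomial (Fin 3) ℤ →+* MvPolynomial (Fin 3) ℚ).range :=
    fun i => ⟨X i, map_X _ _⟩
  -- Coefficients are examined in a free polynomial ring, before specialising to h_1, h_2, e_2,
  -- which satisfy h_1² = h_2 + e_2.
  obtain ⟨Q, hQ⟩ := exists_nat_of_nonneg_of_int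
    (P := X 0 ^ ((a - 2) * b) * reducedValue (X 1) (X 2) a b)
    (mul_mem (pow_mem (hX 0) _) (reducedValue_mem (T := nonnegCoeffs (Fin 3)) (fun r hr m => by
      classical
      rw [algebraMap_eq, coeff_C]
      split_ifs
      · exact hr
      · exact le_rfl) (hX 1) (hX 2) ha hab))
    (mul_mem (pow_mem (hX' 0) _) (reducedValue_mem_of_int (hX' 1) (hX' 2) a b))
  refine ⟨Q, ?_⟩
  have h1 := congrArg (aeval ![(h 1 : MvPowerSeries ℕ ℚ), h 2, e 2]) hQ
  rw [map_mul, map_pow, aeval_X] at h1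
  have h2 : ∀ (x y : MvPolynomial (Fin 3) ℚ), aeval ![(h 1 : MvPowerSeries ℕ ℚ), h 2, e 2]
      (reducedValue x y a b) = reducedValue (aeval ![(h 1 : MvPowerSeries ℕ ℚ), h 2, e 2] x)
        (aeval ![(h 1 : MvPowerSeries ℕ ℚ), h 2, e 2] y) a b := by
    intro x y
    simp only [reducedValue, oddPow, map_mul, map_sub, map_add, map_pow, AlgHom.commutes]
  rw [h2, aeval_X, aeval_X] at h1
  rw [← h_one, p_two, valueAtOne_eq_reducedValue h_one_sq ha hab]
  refine h1.symm.trans ?_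
  rw [aeval_def, eval₂_map]
  congr 1

end NatPolynomial

/-! ### Two determinant identities. -/

section Determinant

variable {R : Type*} [CommRing R]

/-- Cofactor expansion turns both sides into the sum of adj(M)_{ji} M'_{ij} over all i and j. -/
theorem sum_det_updateRow_eq_sum_det_updateCol {n : Type*} [Fintype n] [DecidableEq n]
    (M M' : Matrix n n R) :
    ∑ i, (M.updateRow i (M' i)).det = ∑ j, (M.updateCol j fun i => M' i j).det := by
  have h1 : ∀ i, (M.updateRow i (M' i)).det = ∑ j, M.adjugate j i * M' i j := by
    intro i
    rw [← Matrix.cramer_transpose_apply, Matrix.cramer_eq_adjugate_mulVec,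
      ← Matrix.adjugate_transpose]
    rfl
  have h2 : ∀ j, (M.updateCol j fun i => M' i j).det = ∑ i, M.adjugate j i * M' i j := by
    intro j
    rw [← Matrix.cramer_apply, Matrix.cramer_eq_adjugate_mulVec]
    rfl
  simp only [h1, h2]
  exact sum_comm

theorem det_eq_of_last_row {n : ℕ} (M : Matrix (Fin (n + 1)) (Fin (n + 1)) R)
    (hM : ∀ j : Fin n, M (Fin.last n) j.castSucc = 0) :
    M.det = M (Fin.last n) (Fin.last n) * (M.submatrix Fin.castSucc Fin.castSucc).det := by
  rw [Matrix.det_succ_row M (Fin.last n), Fin.sum_univ_castSucc, sum_eq_zero fun j _ => by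
    rw [hM j, mul_zero, zero_mul], zero_add, Fin.succAbove_last, ← two_mul, pow_mul]
  simp

end Determinant

/-! ### Multiplication by p_1, p_1² and p_2 on Jacobi-Trudi determinants. -/

section JacobiTrudi

/-- `h_{s - t}`, with the convention that it is zero if `s < t`. -/
def hSub (s t : ℕ) : MvPowerSeries ℕ ℚ := if t ≤ s then h (s - t) else 0

theorem hSub_succ_succ (s t : ℕ) : hSub (s + 1) (t + 1) = hSub s t := by
  simp only [hSub, Nat.add_le_add_iff_right, Nat.add_sub_add_right]

theorem hSub_of_lt {s t : ℕ} (hst : s < t) : hSub s t = 0 := if_neg (not_le.2 hst)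

theorem hSub_add_left (s k : ℕ) : hSub (s + k) s = h k := by
  rw [hSub, if_pos (Nat.le_add_right s k), Nat.add_sub_cancel_left]

theorem h_zero : (h 0 : MvPowerSeries ℕ ℚ) = 1 := isNewton_h.1

theorem hSub_self (s : ℕ) : hSub s s = 1 := by
  rw [hSub, if_pos le_rfl, Nat.sub_self, h_zero]

/-- The matrix `(h_{α_i - i + j})` with `N` rows. -/
def jtMatrix (N : ℕ) (α : ℕ → ℕ) : Matrix (Fin N) (Fin N) (MvPowerSeries ℕ ℚ) :=
  Matrix.of fun i j => hSub (α i + j) i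

theorem jtMatrix_apply (N : ℕ) (α : ℕ → ℕ) (i j : Fin N) :
    jtMatrix N α i j = hSub (α i + j) i := rfl

/-- The Jacobi-Trudi determinant `det (h_{α_i - i + j})` with `N` rows. -/
def jt (N : ℕ) (α : ℕ → ℕ) : MvPowerSeries ℕ ℚ := (jtMatrix N α).det

/-- The new last row is (0, …, 0, 1). Empty rows may thus be appended to make room for new boxes. -/
theorem jt_succ_of_eq_zero {N : ℕ} {α : ℕ → ℕ} (hα : α N = 0) : jt (N + 1) α = jt N α := by
  rw [jt, det_eq_of_last_row]
  · have h1 : jtMatrix (N + 1) α (Fin.last N) (Fin.last N) = 1 := by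
      rw [jtMatrix_apply, Fin.val_last, hα, zero_add, hSub_self]
    rw [h1, one_mul]
    rfl
  · intro j
    rw [jtMatrix_apply, Fin.val_last, hα, zero_add]
    exact hSub_of_lt j.2

theorem jt_add_of_eq_zero {N : ℕ} {α : ℕ → ℕ} (k : ℕ) (hα : ∀ i, N ≤ i → α i = 0) :
    jt (N + k) α = jt N α := by
  induction k with
  | zero => rfl
  | succ k ih => rw [← add_assoc, jt_succ_of_eq_zero (hα _ (Nat.le_add_right N k)), ih]

theorem jt_eq_zero_of_succ_eq {N : ℕ} {α : ℕ → ℕ} {i : ℕ} (hi : i + 1 < N)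
    (hα : α (i + 1) = α i + 1) : jt N α = 0 := by
  refine Matrix.det_zero_of_row_eq (i := ⟨i, by omega⟩) (j := ⟨i + 1, hi⟩) ?_ ?_
  · simp
  · ext1 j
    rw [jtMatrix_apply, jtMatrix_apply]
    dsimp only
    rw [hα, show α i + 1 + (j : ℕ) = α i + j + 1 by ring, hSub_succ_succ]

/-- The straightening rule: the two matrices differ by exchanging rows i and i + 1. -/
theorem jt_add_jt_eq_zero {N : ℕ} {α β : ℕ → ℕ} {i : ℕ} (hi : i + 1 < N)
    (h1 : β (i + 1) = α i + 1) (h2 : α (i + 1) = β i + 1)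
    (h3 : ∀ k, k ≠ i → k ≠ i + 1 → α k = β k) : jt N α + jt N β = 0 := by
  have hne : (⟨i, by omega⟩ : Fin N) ≠ ⟨i + 1, hi⟩ := by simp
  have hM : jtMatrix N β =
      (jtMatrix N α).submatrix (Equiv.swap (⟨i, by omega⟩ : Fin N) ⟨i + 1, hi⟩) id := by
    ext1 k j
    rw [Matrix.submatrix_apply, id, jtMatrix_apply, jtMatrix_apply]
    by_cases hk : k = ⟨i, by omega⟩
    · subst hk
      rw [Equiv.swap_apply_left]
      dsimp only
      rw [h2, show β i + 1 + (j : ℕ) = β i + j + 1 by ring, hSub_succ_succ]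
    · by_cases hk' : k = ⟨i + 1, hi⟩
      · subst hk'
        rw [Equiv.swap_apply_right]
        dsimp only
        rw [h1, show α i + 1 + (j : ℕ) = α i + j + 1 by ring, hSub_succ_succ]
      · rw [Equiv.swap_apply_of_ne_of_ne hk hk', h3]
        · exact fun h => hk (Fin.ext h)
        · exact fun h => hk' (Fin.ext h)
  rw [jt, jt, hM, Matrix.det_permute, Equiv.Perm.sign_swap hne]
  simp

/-- Adding k to α_i shifts row i by k columns. Trading rows for columns, column j is replaced by the
would-be column j + k, which repeats an existing one unless j + k ≥ N. -/
theorem sum_jt_add_single (N k : ℕ) (α : ℕ → ℕ) :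
    ∑ i ∈ range N, jt N (α + Pi.single i k) =
      ∑ j : Fin N, ((jtMatrix N α).updateCol j fun i => hSub (α i + (j + k)) i).det := by
  rw [sum_range]
  refine Eq.trans ?_ (sum_det_updateRow_eq_sum_det_updateCol (jtMatrix N α)
    (Matrix.of fun i j => hSub (α i + (j + k)) i))
  refine sum_congr rfl fun i _ => ?_
  rw [jt]
  congr 1
  ext1 l j
  rw [jtMatrix_apply, Matrix.updateRow_apply]
  split_ifs with hl
  · subst hl
    rw [Pi.add_apply, Pi.single_eq_same, Matrix.of_apply]
    congr 1
    ring
  · rw [Pi.add_apply, Pi.single_eq_of_ne (fun h => hl (Fin.ext h)), add_zero, jtMatrix_apply]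

theorem det_updateCol_jtMatrix_eq_zero {N k : ℕ} (α : ℕ → ℕ) (j : Fin N) (hk : k ≠ 0)
    (hj : j + k < N) :
    ((jtMatrix N α).updateCol j fun i => hSub (α i + (j + k)) i).det = 0 := by
  have hne : (⟨j + k, hj⟩ : Fin N) ≠ j := by
    intro h
    have := congrArg Fin.val h
    dsimp only at this
    omega
  refine Matrix.det_zero_of_column_eq (i := j) (j := ⟨j + k, hj⟩) hne.symm fun i => ?_
  rw [Matrix.updateCol_self, Matrix.updateCol_ne hne, jtMatrix_apply]

theorem sum_jt_add_single_one (n : ℕ) (α : ℕ → ℕ) :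
    ∑ i ∈ range (n + 1), jt (n + 1) (α + Pi.single i 1) =
      ((jtMatrix (n + 1) α).updateCol (Fin.last n) fun i => hSub (α i + (n + 1)) i).det := by
  rw [sum_jt_add_single, Fin.sum_univ_castSucc, sum_eq_zero fun j _ =>
    det_updateCol_jtMatrix_eq_zero α _ one_ne_zero (by simp), zero_add]
  rfl

theorem det_updateCol_last {n m : ℕ} {α : ℕ → ℕ} (hα : α n = 0) :
    ((jtMatrix (n + 1) α).updateCol (Fin.last n) fun i => hSub (α i + (n + m)) i).det =
      h m * jt (n + 1) α := by
  rw [jt_succ_of_eq_zero hα, det_eq_of_last_row]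
  · rw [Matrix.updateCol_self, Fin.val_last, hα, zero_add, hSub_add_left]
    congr 2
    ext1 i j
    rw [Matrix.submatrix_apply, Matrix.updateCol_ne (Fin.castSucc_lt_last j).ne]
    rfl
  · intro j
    rw [Matrix.updateCol_ne (Fin.castSucc_lt_last j).ne, jtMatrix_apply, Fin.val_last, hα, zero_add]
    exact hSub_of_lt j.2

theorem sum_jt_add_single_one_of_eq_zero {n : ℕ} {α : ℕ → ℕ} (hα : α n = 0) :
    ∑ i ∈ range (n + 1), jt (n + 1) (α + Pi.single i 1) = h 1 * jt (n + 1) α := by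
  rw [sum_jt_add_single_one, det_updateCol_last hα]

theorem sum_jt_add_single_one_of_succ_eq {n : ℕ} {α : ℕ → ℕ} (hα : α (n + 1) = α n + 1) :
    ∑ i ∈ range (n + 2), jt (n + 2) (α + Pi.single i 1) = 0 := by
  rw [sum_jt_add_single_one]
  refine Matrix.det_zero_of_row_eq (i := (Fin.last n).castSucc) (j := Fin.last (n + 1))
    (Fin.castSucc_lt_last _).ne ?_
  ext1 j
  rw [Matrix.updateCol_apply, Matrix.updateCol_apply, jtMatrix_apply, jtMatrix_apply]
  simp only [Fin.val_castSucc, Fin.val_last, hα]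
  rw [show α n + 1 + (n + 1 + 1) = α n + (n + 1 + 1) + 1 by ring,
    show α n + 1 + (j : ℕ) = α n + j + 1 by ring, hSub_succ_succ, hSub_succ_succ]

/-- Subtracting h_1 times the last column makes the last row (0, …, 0, 1); the row above then ends
in h_2 - h_1² on the diagonal, with zeros before it. -/
theorem det_updateCol_penultimate {n : ℕ} {α : ℕ → ℕ} (hα : α n = 0) (hα' : α (n + 1) = 0) :
    ((jtMatrix (n + 2) α).updateCol (Fin.last n).castSucc fun i => hSub (α i + (n + 2)) i).det =
      (h 2 - h 1 ^ 2) * jt (n + 2) α := by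
  set v : Fin (n + 2) → MvPowerSeries ℕ ℚ := fun i => hSub (α i + (n + 2)) i with hv
  set A := (jtMatrix (n + 2) α).updateCol (Fin.last n).castSucc v with hA
  have hne : (Fin.last n).castSucc ≠ Fin.last (n + 1) := (Fin.castSucc_lt_last _).ne
  set B := A.updateCol (Fin.last n).castSucc
    fun i => A i (Fin.last n).castSucc + (-h 1 : MvPowerSeries ℕ ℚ) • A i (Fin.last (n + 1)) with hB
  have hlast : ∀ j, j ≠ (Fin.last n).castSucc → ∀ i, B i j = hSub (α i + j) i := by
    intro j hj i
    rw [hB, Matrix.updateCol_ne hj, hA, Matrix.updateCol_ne hj, jtMatrix_apply]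
  have hpen : ∀ i, B i (Fin.last n).castSucc =
      hSub (α i + (n + 2)) i - h 1 * hSub (α i + (n + 1)) i := by
    intro i
    rw [hB, Matrix.updateCol_self, hA, Matrix.updateCol_self, Matrix.updateCol_ne hne.symm,
      jtMatrix_apply, Fin.val_last, smul_eq_mul, neg_mul, ← sub_eq_add_neg]
  have hdet : A.det = B.det := (Matrix.det_updateCol_add_smul_self A hne (-h 1)).symm
  rw [hdet, jt_succ_of_eq_zero hα', jt_succ_of_eq_zero hα, det_eq_of_last_row]
  · have h1 : B (Fin.last (n + 1)) (Fin.last (n + 1)) = 1 := by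
      rw [hlast _ hne.symm, Fin.val_last, hα', zero_add, hSub_self]
    rw [h1, one_mul, det_eq_of_last_row]
    · congr 1
      · rw [Matrix.submatrix_apply, hpen, Fin.val_castSucc, Fin.val_last, hα, zero_add, zero_add,
          hSub_add_left, hSub_add_left, pow_two]
      · rw [jt]
        congr 1
        ext1 i j
        rw [Matrix.submatrix_apply, Matrix.submatrix_apply, hlast]
        · rfl
        · exact fun h => (Fin.castSucc_lt_last j).ne (Fin.castSucc_injective _ h)
    · intro j
      rw [Matrix.submatrix_apply, hlast]
      · simp only [Fin.val_castSucc, Fin.val_last, hα, zero_add]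
        exact hSub_of_lt j.2
      · exact fun h => (Fin.castSucc_lt_last j).ne (Fin.castSucc_injective _ h)
  · intro j
    refine Fin.lastCases ?_ (fun j => ?_) j
    · rw [hpen, Fin.val_last, hα', zero_add, zero_add, hSub_self,
        show n + 2 = n + 1 + 1 by ring, hSub_add_left]
      ring
    · rw [hlast, Fin.val_last, hα', zero_add]
      · apply hSub_of_lt
        simp only [Fin.val_castSucc]
        omega
      · exact fun h => (Fin.castSucc_lt_last j).ne (Fin.castSucc_injective _ h)

theorem sum_jt_add_single_two {n : ℕ} {α : ℕ → ℕ} (hα : α n = 0) (hα' : α (n + 1) = 0) :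
    ∑ i ∈ range (n + 2), jt (n + 2) (α + Pi.single i 2) = (h 2 - e 2) * jt (n + 2) α := by
  have h1 : ((jtMatrix (n + 2) α).updateCol (Fin.last (n + 1))
      fun i => hSub (α i + (((Fin.last (n + 1) : Fin (n + 2)) : ℕ) + 2)) i).det =
      h 2 * jt (n + 2) α := det_updateCol_last hα'
  have h2 : ((jtMatrix (n + 2) α).updateCol (Fin.last n).castSucc
      fun i => hSub (α i + (((Fin.last n).castSucc : ℕ) + 2)) i).det =
      (h 2 - h 1 ^ 2) * jt (n + 2) α := det_updateCol_penultimate hα hα'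
  rw [sum_jt_add_single, Fin.sum_univ_castSucc, Fin.sum_univ_castSucc, sum_eq_zero fun j _ =>
    det_updateCol_jtMatrix_eq_zero α _ two_ne_zero (by simp), zero_add, h1, h2, h_one_sq]
  ring

theorem sum_jt_add_single_add_single {n : ℕ} {α : ℕ → ℕ} (hα : α n = 0) (hα' : α (n + 1) = 0) :
    ∑ i ∈ range (n + 2), ∑ j ∈ range (n + 2),
      jt (n + 2) (α + Pi.single i 1 + Pi.single j 1) = (h 2 + e 2) * jt (n + 2) α := by
  have hsucc : (α + Pi.single (n + 1) 1 : ℕ → ℕ) (n + 1) = (α + Pi.single (n + 1) 1 : ℕ → ℕ) n + 1 := by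
    simp [hα, hα']
  -- A first box in row n + 1, below the empty row n, contributes nothing; the other terms still end
  -- in an empty row, so the h_1 rule applies again.
  rw [sum_range_succ, sum_jt_add_single_one_of_succ_eq hsucc, add_zero, ← h_one_sq, pow_two,
    mul_assoc, ← sum_jt_add_single_one_of_eq_zero hα', sum_range_succ _ (n + 1),
    jt_eq_zero_of_succ_eq (i := n) (by omega) hsucc, add_zero, mul_sum]
  refine sum_congr rfl fun i hi => sum_jt_add_single_one_of_eq_zero ?_
  rw [mem_range] at hi
  rw [Pi.add_apply, hα', Pi.single_eq_of_ne (by omega), add_zero]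

end JacobiTrudi

/-! ### Pieri rules and Schur positivity. -/

section Pieri

theorem SchurPositive.zero : SchurPositive 0 := ⟨0, Finsupp.sum_zero_index.symm⟩

theorem SchurPositive.add {f g : MvPowerSeries ℕ ℚ} (hf : SchurPositive f)
    (hg : SchurPositive g) : SchurPositive (f + g) := by
  classical
  obtain ⟨c, rfl⟩ := hf
  obtain ⟨d, rfl⟩ := hg
  exact ⟨c + d, (Finsupp.sum_add_index' (h := fun μ n => n • SymFun.schur μ)
    (fun _ => zero_nsmul _) fun _ _ _ => add_nsmul _ _ _).symm⟩

theorem SchurPositive.sum {ι : Type*} (s : Finset ι) {f : ι → MvPowerSeries ℕ ℚ}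
    (hf : ∀ i ∈ s, SchurPositive (f i)) : SchurPositive (∑ i ∈ s, f i) := by
  classical
  induction s using Finset.induction_on with
  | empty => exact SchurPositive.zero
  | insert i s hi ih =>
    rw [sum_insert hi]
    exact (hf i (mem_insert_self i s)).add (ih fun j hj => hf j (mem_insert_of_mem hj))

theorem SchurPositive.nsmul {f : MvPowerSeries ℕ ℚ} (hf : SchurPositive f) (n : ℕ) :
    SchurPositive (n • f) := by
  induction n with
  | zero => rw [zero_nsmul]; exact SchurPositive.zero
  | succ n ih => rw [succ_nsmul]; exact ih.add hf

theorem SchurPositive.schur (μ : YoungDiagram) : SchurPositive (schur μ) :=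
  ⟨Finsupp.single μ 1, by
    rw [Finsupp.sum_single_index (h := fun μ n => n • SymFun.schur μ) (zero_nsmul _), one_nsmul]⟩

theorem SchurPositive.mul {f g : MvPowerSeries ℕ ℚ} (hf : SchurPositive f)
    (hg : ∀ μ, SchurPositive (g * SymFun.schur μ)) : SchurPositive (g * f) := by
  obtain ⟨c, rfl⟩ := hf
  rw [Finsupp.sum, mul_sum]
  refine SchurPositive.sum _ fun μ _ => ?_
  rw [mul_smul_comm]
  exact (hg μ).nsmul _

theorem rowLen_eq_zero (μ : YoungDiagram) (i : ℕ) (hi : μ.colLen 0 ≤ i) : μ.rowLen i = 0 := by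
  by_contra h0
  have h1 : (i, 0) ∈ μ := YoungDiagram.mem_iff_lt_rowLen.2 (Nat.pos_of_ne_zero h0)
  rw [YoungDiagram.mem_iff_lt_colLen] at h1
  omega

theorem schur_eq_jt (μ : YoungDiagram) (k : ℕ) : schur μ = jt (μ.colLen 0 + k) μ.rowLen := by
  rw [jt_add_of_eq_zero k (rowLen_eq_zero μ)]
  rfl

theorem exists_rowLen_eq {N : ℕ} {α : ℕ → ℕ} (hα : Antitone α) (h0 : ∀ i, N ≤ i → α i = 0) :
    ∃ μ : YoungDiagram, μ.rowLen = α := by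
  let μ : YoungDiagram :=
    { cells := {c ∈ range N ×ˢ range (α 0) | c.2 < α c.1}
      isLowerSet := by
        rintro ⟨i, j⟩ ⟨i', j'⟩ hle hmem
        obtain ⟨hi, hj⟩ := Prod.mk_le_mk.1 hle
        simp only [coe_filter, mem_product, mem_range, Set.mem_ofPred_eq] at hmem ⊢
        have := hα hi
        omega }
  have hμ : ∀ i j, (i, j) ∈ μ ↔ j < α i := by
    intro i j
    rw [← YoungDiagram.mem_cells]
    simp only [μ, mem_filter, mem_product, mem_range]
    refine ⟨fun h => h.2, fun h => ⟨⟨?_, ?_⟩, h⟩⟩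
    · by_contra! hN
      rw [h0 i hN] at h
      omega
    · exact h.trans_le (hα (Nat.zero_le i))
  refine ⟨μ, funext fun i => ?_⟩
  have h1 : ∀ j, j < μ.rowLen i ↔ j < α i := fun j => by
    rw [← YoungDiagram.mem_iff_lt_rowLen, hμ]
  have h2 := h1 (α i)
  have h3 := h1 (μ.rowLen i)
  omega

/-- A Jacobi-Trudi determinant is Schur positive if each row is at most one longer than the
preceding one. -/
theorem schurPositive_jt {N : ℕ} {α : ℕ → ℕ} (hα : ∀ i, α (i + 1) ≤ α i + 1)
    (h0 : ∀ i, N ≤ i → α i = 0) : SchurPositive (jt N α) := by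
  by_cases hanti : ∀ i, α (i + 1) ≤ α i
  · obtain ⟨μ, rfl⟩ := exists_rowLen_eq (antitone_nat_of_succ_le hanti) h0
    have hle : μ.colLen 0 ≤ N := by
      by_contra! hlt
      have h1 : (N, 0) ∈ μ := YoungDiagram.mem_iff_lt_colLen.2 hlt
      rw [YoungDiagram.mem_iff_lt_rowLen, h0 N le_rfl] at h1
      omega
    obtain ⟨k, rfl⟩ := Nat.exists_eq_add_of_le hle
    rw [← schur_eq_jt]
    exact SchurPositive.schur μ
  · push Not at hanti
    obtain ⟨i, hi⟩ := hanti
    have h1 := hα i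
    have hN : i + 1 < N := by
      by_contra! hN
      rw [h0 _ hN] at hi
      omega
    rw [jt_eq_zero_of_succ_eq hN (by omega)]
    exact SchurPositive.zero

theorem add_single_add_single_eq_zero {N i j : ℕ} {α : ℕ → ℕ} (h0 : ∀ k, N ≤ k → α k = 0)
    (hi : i < N) (hj : j < N) (k : ℕ) (hk : N ≤ k) :
    (α + Pi.single i 1 + Pi.single j 1 : ℕ → ℕ) k = 0 := by
  simp only [Pi.add_apply, Pi.single_apply, h0 k hk]
  rw [if_neg (by omega), if_neg (by omega), add_zero, add_zero]

theorem schurPositive_jt_add_single {N i : ℕ} {α : ℕ → ℕ} (hα : ∀ k, α (k + 1) ≤ α k)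
    (h0 : ∀ k, N ≤ k → α k = 0) (hi : i < N) : SchurPositive (jt N (α + Pi.single i 1)) := by
  refine schurPositive_jt (fun k => ?_) fun k hk => ?_
  · have := hα k
    simp only [Pi.add_apply, Pi.single_apply]
    split_ifs <;> omega
  · rw [Pi.add_apply, h0 k hk, Pi.single_eq_of_ne (by omega), add_zero]

theorem schurPositive_jt_add_single_add_single {N i j : ℕ} {α : ℕ → ℕ}
    (hα : ∀ k, α (k + 1) ≤ α k) (h0 : ∀ k, N ≤ k → α k = 0) (hi : i < N) (hj : j < N)
    (hij : i ≠ j) : SchurPositive (jt N (α + Pi.single i 1 + Pi.single j 1)) := by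
  refine schurPositive_jt (fun k => ?_) (add_single_add_single_eq_zero h0 hi hj)
  have := hα k
  simp only [Pi.add_apply, Pi.single_apply]
  split_ifs <;> omega

theorem schurPositive_jt_add_two_zero {N : ℕ} {α : ℕ → ℕ} (hα : ∀ k, α (k + 1) ≤ α k)
    (h0 : ∀ k, N ≤ k → α k = 0) (hN : 0 < N) :
    SchurPositive (jt N (α + Pi.single 0 1 + Pi.single 0 1)) := by
  refine schurPositive_jt (fun k => ?_) (add_single_add_single_eq_zero h0 hN hN)
  have := hα k
  simp only [Pi.add_apply, Pi.single_apply]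
  split_ifs <;> first | omega | contradiction

/-- Two boxes in row i + 1 may break the shape. If rows i and i + 1 are equal, the bad term cancels
against one box in each row by straightening; otherwise both terms are Schur positive. -/
theorem schurPositive_jt_add_two_succ {N i : ℕ} {α : ℕ → ℕ} (hα : ∀ k, α (k + 1) ≤ α k)
    (h0 : ∀ k, N ≤ k → α k = 0) (hi : i + 1 < N) :
    SchurPositive (jt N (α + Pi.single i 1 + Pi.single (i + 1) 1) +
      jt N (α + Pi.single (i + 1) 1 + Pi.single (i + 1) 1)) := by
  rcases (hα i).eq_or_lt with heq | hlt
  · rw [jt_add_jt_eq_zero hi]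
    · exact SchurPositive.zero
    · simp [heq]
    · simp [heq]
    · intro k h1 h2
      simp [h1, h2]
  · refine (schurPositive_jt_add_single_add_single hα h0 (by omega) hi (by omega)).add
      (schurPositive_jt (fun k => ?_) (add_single_add_single_eq_zero h0 hi hi))
    have := hα k
    simp only [Pi.add_apply, Pi.single_apply]
    by_cases hk : k = i
    · subst hk
      simp
      omega
    · split_ifs <;> omega

theorem sum_range_sum_range_symm (N : ℕ) {g : ℕ → ℕ → MvPowerSeries ℕ ℚ}
    (hg : ∀ i j, g i j = g j i) :
    ∑ i ∈ range N, ∑ j ∈ range N, g i j =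
      2 * ∑ j ∈ range N, ∑ i ∈ range j, g i j + ∑ i ∈ range N, g i i := by
  induction N with
  | zero => simp
  | succ N ih =>
    simp only [sum_range_succ _ N, sum_add_distrib, ih]
    rw [sum_congr rfl fun i _ => hg N i]
    ring

/-- From 2e_2 = p_1² - p_2: the diagonal terms of the double sum for p_1² are those for p_2, and the
others occur in equal pairs. -/
theorem e_two_mul_jt {n : ℕ} {α : ℕ → ℕ} (hα : α n = 0) (hα' : α (n + 1) = 0) :
    e 2 * jt (n + 2) α = ∑ j ∈ range (n + 2), ∑ i ∈ range j,
      jt (n + 2) (α + Pi.single i 1 + Pi.single j 1) := by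
  have h1 := sum_jt_add_single_add_single hα hα'
  have h2 := sum_jt_add_single_two hα hα'
  rw [sum_range_sum_range_symm _ fun i j => by rw [add_right_comm]] at h1
  simp only [add_assoc, ← Pi.single_add, Nat.reduceAdd] at h1 h2 ⊢
  have h3 : (2 : MvPowerSeries ℕ ℚ) * (e 2 * jt (n + 2) α) = 2 * ∑ j ∈ range (n + 2),
      ∑ i ∈ range j, jt (n + 2) (α + (Pi.single i 1 + Pi.single j 1)) := by
    linear_combination h2 - h1
  exact natCast_succ_mul_cancel (n := 1) (by exact_mod_cast h3)

theorem h_two_mul_jt {n : ℕ} {α : ℕ → ℕ} (hα : α n = 0) (hα' : α (n + 1) = 0) :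
    h 2 * jt (n + 2) α = ∑ j ∈ range (n + 2), ∑ i ∈ range j,
      jt (n + 2) (α + Pi.single i 1 + Pi.single j 1) +
      ∑ i ∈ range (n + 2), jt (n + 2) (α + Pi.single i 1 + Pi.single i 1) := by
  have h2 := sum_jt_add_single_two hα hα'
  rw [← e_two_mul_jt hα hα']
  simp only [add_assoc, ← Pi.single_add, Nat.reduceAdd] at h2 ⊢
  rw [h2]
  ring

theorem rowLen_succ_le (μ : YoungDiagram) (i : ℕ) : μ.rowLen (i + 1) ≤ μ.rowLen i :=
  μ.rowLen_anti _ _ (Nat.le_succ i)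

theorem schurPositive_h_one_mul (μ : YoungDiagram) : SchurPositive (h 1 * schur μ) := by
  rw [schur_eq_jt μ 1, ← sum_jt_add_single_one_of_eq_zero (rowLen_eq_zero μ _ le_rfl)]
  exact SchurPositive.sum _ fun i hi => schurPositive_jt_add_single (rowLen_succ_le μ)
    (fun k hk => rowLen_eq_zero μ k (by omega)) (mem_range.1 hi)

theorem schurPositive_e_two_mul (μ : YoungDiagram) : SchurPositive (e 2 * schur μ) := by
  rw [schur_eq_jt μ 2, e_two_mul_jt (rowLen_eq_zero μ _ le_rfl)
    (rowLen_eq_zero μ _ (Nat.le_succ _))]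
  refine SchurPositive.sum _ fun j hj => SchurPositive.sum _ fun i hi => ?_
  rw [mem_range] at hi hj
  exact schurPositive_jt_add_single_add_single (rowLen_succ_le μ)
    (fun k hk => rowLen_eq_zero μ k (by omega)) (by omega) hj (by omega)

theorem schurPositive_h_two_mul (μ : YoungDiagram) : SchurPositive (h 2 * schur μ) := by
  have h0 : ∀ k, μ.colLen 0 + 2 ≤ k → μ.rowLen k = 0 :=
    fun k hk => rowLen_eq_zero μ k (by omega)
  rw [schur_eq_jt μ 2, h_two_mul_jt (rowLen_eq_zero μ _ le_rfl)
    -- The double box in row i + 1 is grouped with the pair of rows i, i + 1; only the double box in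
    -- row 0 stays alone, and it is harmless.
    (rowLen_eq_zero μ _ (Nat.le_succ _)), ← sum_add_distrib, sum_range_succ']
  refine SchurPositive.add (SchurPositive.sum _ fun i hi => ?_) ?_
  · rw [mem_range] at hi
    rw [sum_range_succ, add_assoc]
    refine SchurPositive.add (SchurPositive.sum _ fun j hj => ?_)
      (schurPositive_jt_add_two_succ (rowLen_succ_le μ) h0 (by omega))
    rw [mem_range] at hj
    exact schurPositive_jt_add_single_add_single (rowLen_succ_le μ) h0 (by omega) (by omega)
      (by omega)
  · rw [sum_range_zero, zero_add]
    exact schurPositive_jt_add_two_zero (rowLen_succ_le μ) h0 (by omega)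

theorem schurPositive_one : SchurPositive 1 := by
  have h1 : jt 0 0 = 1 := Matrix.det_isEmpty
  rw [← h1]
  exact schurPositive_jt (fun _ => Nat.zero_le _) fun _ _ => rfl

theorem IsNatPolynomial.schurPositive {f : MvPowerSeries ℕ ℚ} (hf : IsNatPolynomial f) :
    SchurPositive f := by
  obtain ⟨P, rfl⟩ := hf
  induction P using MvPolynomial.induction_on with
  | C n =>
    rw [MvPolynomial.eval₂_C, eq_natCast, ← nsmul_one]
    exact schurPositive_one.nsmul n
  | add P Q hP hQ =>
    rw [MvPolynomial.eval₂_add]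
    exact hP.add hQ
  | mul_X P i hP =>
    rw [MvPolynomial.eval₂_mul, MvPolynomial.eval₂_X, mul_comm]
    refine hP.mul fun μ => ?_
    fin_cases i
    · exact schurPositive_h_one_mul μ
    · exact schurPositive_h_two_mul μ
    · exact schurPositive_e_two_mul μ

end Pieri

end SymFun

end

theorem proposition3p1 (a b : ℕ) (ha : 1 < a) (hab : a < b) :
    ∃ f : MvPowerSeries ℕ ℚ,
      SymFun.HasValueAt (SymFun.F a b) 1 f ∧
      f = (1 / 2 : ℚ) •
        (((a : ℚ) * b * ((b : ℚ) - a)) • (SymFun.h 1 ^ (a * b - 2) * SymFun.e 2)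
          + ((a : ℚ) * ((a : ℚ) - 1)) • (SymFun.h 1 ^ ((a - 2) * b) * SymFun.oddPart b)
          - ((b : ℚ) * ((b : ℚ) - 1)) • (SymFun.h 1 ^ (a * (b - 2)) * SymFun.oddPart a)) ∧
      SymFun.IsNatPolynomial f ∧
      SymFun.SchurPositive f :=
  ⟨SymFun.valueAtOne (SymFun.p 1) (SymFun.p 2) a b, SymFun.hasValueAt_F ha (ha.trans hab),
    SymFun.valueAtOne_eq a b, SymFun.isNatPolynomial_valueAtOne ha hab,
    (SymFun.isNatPolynomial_valueAtOne ha hab).schurPositive⟩
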